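/- **Setting.** Let $d\ge 1$. A polygonal curve in $\mathbb R^d$ is given by vertices $v_1,\dots,v_k\in\mathbb R^d$ ($k\ge 2$) and instants $0=t_1<\dots<t_k=1$; it is the map $\tau\colon[0,1]\to\mathbb R^d$ that runs affinely from $v_i$ to $v_{i+1}$ on $[t_i,t_{i+1}]$ (redundant vertices and doubling back are allowed). Its complexity is $|\tau|=k$; curves that differ by a reparametrization are identified, and $\mathbb X^d_\ell$ is the class of polygonal curves of complexity at most $\ell$. Let $d_F(\sigma,\tau)=\inf_h\max_{t\in[0,1]}\lVert\sigma(t)-\tau(h(t))\rVert$ be the Fréchet distance, where $h$ ranges over the continuous bijections of $[0,1]$ with $h(0)=0$, $h(1)=1$. For a finite family $X$ of curves let $\mathrm{cost}(X,c)=\sum_{\tau\in X}d_F(\tau,c)$ (with multiplicity). A curve $c$ (of any complexity) is an $\alpha$-approximate $(1,\ell)$-median of $X$ if $\mathrm{cost}(X,c)\le\alpha\,\mathrm{cost}(X,c')$ for all $c'\in\mathbb X^d_\ell$. For $r>0$ and $A\subseteq\mathbb R^d$ let $\mathbb G(A,r)=\{(\lfloor p_1/r\rfloor r,\dots,\lfloor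 p_d/r\rfloor r)\mid p\in A\}$, and let $B(p,r)$ be the closed Euclidean ball. Fix $\ell\ge 3$ and a map $\mathrm{simpl}$ that sends every polygonal curve $\tau$ to a curve $\mathrm{simpl}(\tau)\in\mathbb X^d_\ell$ with $d_F(\tau,\mathrm{simpl}(\tau))\le 4\,d_F(\tau,\sigma)$ for all $\sigma\in\mathbb X^d_\ell$. Ties in $\arg\min$ are broken by an arbitrary fixed rule. All samples are uniform, independent and with replacement. **Algorithm 1** (input: a finite nonempty family $X$ of curves, $\delta\in(0,1)$). Sample $\lceil 2(\ln 2-\ln\delta)\rceil$ curves from $X$ and let $R$ be the set of their images under $\mathrm{simpl}$. Sample a family $W$ of $\lceil -64(\ln\delta-\ln\lceil 4\ln 2-\ln\delta\rceil)\rceil$ curves from $X$. Return $\arg\min_{c\in R}\mathrm{cost}(W,c)$. **Algorithm 4** (input: $T=(\tau_1,\dots,\tau_n)$, $\beta,\delta,\varepsilon$). Let $\varepsilon'=\varepsilon/6$. Draw a sample $S$ of $\lceil -8\beta\ell(\varepsilon')^{-1}(\ln\delta-\ln(4(2\ell-4)))\rceil$ curves from $T$. For every subfamily $S'$ of $S$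 with $|S'|=\lceil |S|/(2\beta)\rceil$: run Algorithm 1 (with fresh randomness) on $(S',\delta/4)$ to get $c$; put $\Delta=\mathrm{cost}(S',c)$, $\Delta_l=\frac{2\delta n}{4|S|}\cdot\frac{\Delta}{34}$, $\Delta_u=\Delta/\varepsilon'$; let $P$ be the union of the grids $\mathbb G\big(B(v,\frac{4\ell}{\varepsilon'}\Delta_u),\frac{2\varepsilon'}{n\sqrt d}\Delta_l\big)$ over all vertices $v$ of all curves of $S'$ ($P=\emptyset$ if $\Delta=0$); add to the candidate set the curve $c$ and all polygonal curves with at most $2\ell-2$ vertices, all of them in $P$. Return the candidate set. **Theorem.** Let $\beta\in[1,\infty)$, $\delta\in(0,1)$, $\varepsilon\in(0,0.158]$, and let $T=(\tau_1,\dots,\tau_n)$, $n\ge 1$, be polygonal curves in $\mathbb R^d$. For every subfamily $T'\subseteq T$ with $|T'|\ge\frac1\beta|T|$, with probability at least $1-\delta$ the candidate set returned by Algorithm 4 on $(T,\beta,\delta,\varepsilon)$ contains a curve with at most $2\ell-2$ vertices that is a $(1+\varepsilon)$-approximate $(1,\ell)$-median of $T'$. -/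

import Mathlib

/-- The ambient space `ℝ^d` with the Euclidean norm. -/
abbrev Pt (d : ℕ) := EuclideanSpace ℝ (Fin d)

/-- A polygonal curve in `ℝ^d`, given by its vertices `v_0, …, v_edges` and its instants
`0 = t_0 < … < t_edges = 1`. The conditions on the instants force `1 ≤ edges`.
Redundant vertices and doubling back are allowed. -/
structure PolyCurve (d : ℕ) where
  edges : ℕ
  vertex : Fin (edges + 1) → Pt d
  instant : Fin (edges + 1) → ℝ
  instant_strictMono : StrictMono instant
  instant_zero : instant 0 = 0
  instant_last : instant (Fin.last edges) = 1

namespace PolyCurve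

variable {d : ℕ}

/-- The complexity `|τ|`: the number of vertices. -/
def complexity (τ : PolyCurve d) : ℕ := τ.edges + 1

/-- The fraction of the `i`-th edge that has been traversed at time `t`
(`0` before the edge, `1` after it). -/
noncomputable def progress (τ : PolyCurve d) (i : Fin τ.edges) (t : ℝ) : ℝ :=
  max 0 (min 1 ((t - τ.instant i.castSucc) / (τ.instant i.succ - τ.instant i.castSucc)))

/-- The parametrized curve `[0,1] → ℝ^d`: on `[t_i, t_{i+1}]` it runs along the line segment
from `v_i` to `v_{i+1}`, see `toCurve_eq_lineMap`. -/
noncomputable def toCurve (τ : PolyCurve d) : C(unitInterval, Pt d) where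
  toFun t := τ.vertex 0 +
    ∑ i : Fin τ.edges, τ.progress i t • (τ.vertex i.succ - τ.vertex i.castSucc)
  continuous_toFun := by
    unfold progress
    fun_prop

theorem toCurve_eq_lineMap (τ : PolyCurve d) (i : Fin τ.edges) (t : unitInterval)
    (h₁ : τ.instant i.castSucc ≤ t) (h₂ : (t : ℝ) ≤ τ.instant i.succ) :
    τ.toCurve t = AffineMap.lineMap (τ.vertex i.castSucc) (τ.vertex i.succ)
      (((t : ℝ) - τ.instant i.castSucc) / (τ.instant i.succ - τ.instant i.castSucc)) := by
  set s : ℝ := ((t : ℝ) - τ.instant i.castSucc) / (τ.instant i.succ - τ.instant i.castSucc)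
    with hs
  have hpos : ∀ j : Fin τ.edges, 0 < τ.instant j.succ - τ.instant j.castSucc := fun j =>
    sub_pos.2 (τ.instant_strictMono j.castSucc_lt_succ)
  have hprog : ∀ j : Fin τ.edges, τ.progress j t =
      (if j < i then 1 else 0) + (if j = i then s else 0) := by
    intro j
    unfold progress
    rcases lt_trichotomy j i with hj | hj | hj
    · have hle : τ.instant j.succ ≤ t := by
        refine le_trans (τ.instant_strictMono.monotone ?_) h₁
        rw [Fin.le_def]; simpa using hj
      have : 1 ≤ ((t : ℝ) - τ.instant j.castSucc) /
          (τ.instant j.succ - τ.instant j.castSucc) := by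
        rw [le_div_iff₀ (hpos j)]; linarith
      simp [hj, hj.ne, min_eq_left this]
    · subst hj
      have h0 : 0 ≤ s := div_nonneg (sub_nonneg.2 h₁) (hpos j).le
      have h1 : s ≤ 1 := by
        rw [hs, div_le_one (hpos j)]; linarith
      simp [← hs, h0, h1]
    · have hle : (t : ℝ) ≤ τ.instant j.castSucc := by
        refine le_trans h₂ (τ.instant_strictMono.monotone ?_)
        rw [Fin.le_def]; simpa using hj
      have : ((t : ℝ) - τ.instant j.castSucc) /
          (τ.instant j.succ - τ.instant j.castSucc) ≤ 0 :=
        div_nonpos_of_nonpos_of_nonneg (sub_nonpos.2 hle) (hpos j).le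
      simp [hj.not_gt, hj.ne', (min_le_right _ _).trans this]
  have htel : ∑ j : Fin τ.edges, (if j < i then (1 : ℝ) else 0) •
      (τ.vertex j.succ - τ.vertex j.castSucc) = τ.vertex i.castSucc - τ.vertex 0 := by
    let u : ℕ → Pt d := fun k => if h : k < τ.edges + 1 then τ.vertex ⟨k, h⟩ else 0
    have hu : ∀ j : Fin τ.edges, (if j < i then (1 : ℝ) else 0) •
        (τ.vertex j.succ - τ.vertex j.castSucc) =
        (fun k : ℕ => if k < (i : ℕ) then u (k + 1) - u k else 0) j := by
      intro j
      have e1 : u ((j : ℕ) + 1) = τ.vertex j.succ := by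
        simp only [u]; rw [dif_pos (by omega)]; rfl
      have e2 : u (j : ℕ) = τ.vertex j.castSucc := by
        simp only [u]; rw [dif_pos (by omega)]; rfl
      simp only [e1, e2, ← Fin.lt_def]
      split_ifs <;> simp
    rw [Finset.sum_congr rfl (fun j _ => hu j), Fin.sum_univ_eq_sum_range
      (fun k : ℕ => if k < (i : ℕ) then u (k + 1) - u k else 0), ← Finset.sum_filter]
    have : (Finset.range τ.edges).filter (fun k => k < (i : ℕ)) = Finset.range i := by
      ext k; simp only [Finset.mem_filter, Finset.mem_range]; omega
    rw [this, Finset.sum_range_sub]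
    congr 1
    · simp only [u]; rw [dif_pos (by omega)]; rfl
  change τ.vertex 0 + ∑ j : Fin τ.edges, τ.progress j t • _ = _
  simp only [hprog, add_smul, Finset.sum_add_distrib, ite_smul, zero_smul,
    Finset.sum_ite_eq', Finset.mem_univ, if_true, one_smul] at htel ⊢
  rw [htel, AffineMap.lineMap_apply, vsub_eq_sub, vadd_eq_add]
  abel

end PolyCurve

/-- `𝓗`: the continuous bijections `h : [0,1] → [0,1]` with `h 0 = 0` and `h 1 = 1`. -/
def Reparam : Set C(unitInterval, unitInterval) := {h | Function.Bijective h ∧ h 0 = 0 ∧ h 1 = 1}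

/-- The (continuous) Fréchet distance
`inf_{h ∈ 𝓗} max_{t ∈ [0,1]} ‖σ(t) - τ(h(t))‖` of two polygonal curves. -/
noncomputable def frechetDist {d : ℕ} (σ τ : PolyCurve d) : ℝ :=
  ⨅ h : Reparam, ⨆ t : unitInterval, ‖σ.toCurve t - τ.toCurve (h.1 t)‖

/-- `cost(X, c)`: the sum of the Fréchet distances from the members of a finite family `X`
(counted with multiplicity) to `c`. -/
noncomputable def cost {d : ℕ} {κ : Type*} [Fintype κ] (X : κ → PolyCurve d)
    (c : PolyCurve d) : ℝ := ∑ i, frechetDist (X i) c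

/-- `σ` is an `α`-approximate minimum-error `ℓ`-simplification of `τ`. -/
def IsApproxSimplification {d : ℕ} (α : ℝ) (ℓ : ℕ) (τ σ : PolyCurve d) : Prop :=
  σ.complexity ≤ ℓ ∧
    ∀ σ' : PolyCurve d, σ'.complexity ≤ ℓ → frechetDist τ σ ≤ α * frechetDist τ σ'

/-- The cost of `c` is at most `α` times that of every curve of complexity at most `ℓ`, that is,
at most `α` times the cost of an optimal `(1,ℓ)`-median. The complexity of `c` is not
restricted here. -/
def IsApproxMedian {d : ℕ} {κ : Type*} [Fintype κ] (α : ℝ) (ℓ : ℕ) (X : κ → PolyCurve d)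
    (c : PolyCurve d) : Prop :=
  ∀ c' : PolyCurve d, c'.complexity ≤ ℓ → cost X c ≤ α * cost X c'

/-- A rule that returns, for each finite nonempty set `A` and each objective `f`, a minimizer of
`f` on `A`; it fixes how ties are broken. -/
def IsArgminRule {α : Type*} (argmin : Set α → (α → ℝ) → α) : Prop :=
  ∀ (A : Set α) (f : α → ℝ), A.Finite → A.Nonempty →
    argmin A f ∈ A ∧ ∀ x ∈ A, f (argmin A f) ≤ f x

/-- The `r`-grid-point of `p`. -/
noncomputable def gridPoint {d : ℕ} (r : ℝ) (p : Pt d) : Pt d :=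
  WithLp.toLp 2 fun i => (⌊p i / r⌋ : ℝ) * r

/-- The grid of cell width `r` that covers `A`. It is a notion for `r > 0` only;
for other `r` we take the empty set. -/
def gridCover {d : ℕ} (A : Set (Pt d)) (r : ℝ) : Set (Pt d) :=
  {q | 0 < r ∧ ∃ p ∈ A, q = gridPoint r p}

/-! ### The 34-approximation for the `(1,ℓ)`-median by simplification -/

/-- The size of the first sample. -/
noncomputable def sizeS (δ : ℝ) : ℕ := ⌈2 * (Real.log 2 - Real.log δ)⌉₊

/-- The size of the second sample. -/
noncomputable def sizeW (δ : ℝ) : ℕ :=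
  ⌈-64 * (Real.log δ - Real.log (⌈4 * Real.log 2 - Real.log δ⌉₊ : ℝ))⌉₊

/-- The two samples with replacement, as indices into the input family. -/
abbrev Coins34 (κ : Type) (δ : ℝ) := (Fin (sizeS δ) → κ) × (Fin (sizeW δ) → κ)

/-- The curve returned on input `X` and `δ` when the two samples are `ω`: of the simplified
members of the first sample, one that is cheapest for the second sample. -/
noncomputable def median34 {d : ℕ} (simplify : PolyCurve d → PolyCurve d)
    (argmin : Set (PolyCurve d) → (PolyCurve d → ℝ) → PolyCurve d)
    {κ : Type} (X : κ → PolyCurve d) (δ : ℝ) (ω : Coins34 κ δ) : PolyCurve d :=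
  argmin (Set.range fun i => simplify (X (ω.1 i))) (fun c => cost (fun j => X (ω.2 j)) c)

/-! ### The candidate algorithm by advanced shortcutting -/

/-- The size `|S|` of the sample; here `ε' = ε / 6`. -/
noncomputable def sampleSize (ℓ : ℕ) (β δ ε : ℝ) : ℕ :=
  ⌈-8 * β * ℓ * (ε / 6)⁻¹ * (Real.log δ - Real.log (4 * (2 * (ℓ : ℝ) - 4)))⌉₊

/-- The cardinality `|S| / (2β)` of the subsets `S'`, rounded up. -/
noncomputable def subsampleSize (ℓ : ℕ) (β δ ε : ℝ) : ℕ :=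
  ⌈(sampleSize ℓ β δ ε : ℝ) / (2 * β)⌉₊

/-- The subsets `S'` of the sample over which the algorithm loops, as sets of positions. -/
abbrev Subsample (ℓ : ℕ) (β δ ε : ℝ) :=
  {A : Finset (Fin (sampleSize ℓ β δ ε)) // A.card = subsampleSize ℓ β δ ε}

/-- All random choices of a run on `n` input curves: the sample `S`, drawn with replacement, and
for every `S'` the samples of the corresponding call of the 34-approximation on `S'` with
failure probability `δ / 4`. A uniformly random element consists of independent uniform draws. -/
abbrev Coins (n ℓ : ℕ) (β δ ε : ℝ) :=
  (Fin (sampleSize ℓ β δ ε) → Fin n) ×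
    ((A : Subsample ℓ β δ ε) → Coins34 {j // j ∈ A.1} (δ / 4))

/-- The points of the grids for the subset `Y = S'`, where `N = |S|` and `Δ = cost(S', c)`:
`Δ_l = (2δn / (4N)) (Δ / 34)`, `Δ_u = Δ / ε'`, and every vertex of a member of `S'` contributes the
grid of cell width `(2ε' / (n √d)) Δ_l` that covers the ball of radius `(4ℓ / ε') Δ_u` around it. -/
noncomputable def gridPoints {d : ℕ} (n ℓ N : ℕ) (δ ε' Δ : ℝ) {κ : Type}
    (Y : κ → PolyCurve d) : Set (Pt d) :=
  let Δl : ℝ := 2 * δ * n / (4 * N) * (Δ / 34)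
  let Δu : ℝ := 1 / ε' * Δ
  ⋃ (j : κ) (i : Fin ((Y j).edges + 1)),
    gridCover (Metric.closedBall ((Y j).vertex i) (4 * ℓ / ε' * Δu))
      (2 * ε' / (n * Real.sqrt d) * Δl)

/-- The candidates contributed by a single subset `Y = S'`: the curve `c` and all polygonal curves
(up to reparametrization: all instants are admitted) with up to `2ℓ - 2` vertices from the grids. -/
noncomputable def subsampleCandidates {d : ℕ} (n ℓ N : ℕ) (δ ε' : ℝ) {κ : Type} [Fintype κ]
    (Y : κ → PolyCurve d) (c : PolyCurve d) : Set (PolyCurve d) :=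
  {c} ∪ {γ | γ.complexity ≤ 2 * ℓ - 2 ∧
    ∀ i, γ.vertex i ∈ gridPoints n ℓ N δ ε' (cost Y c) Y}

/-- The candidate set returned on input `T`, `β`, `δ`, `ε` when the random choices are `ω`. -/
noncomputable def candidates {d n : ℕ} (simplify : PolyCurve d → PolyCurve d)
    (argmin : Set (PolyCurve d) → (PolyCurve d → ℝ) → PolyCurve d)
    (ℓ : ℕ) (T : Fin n → PolyCurve d) (β δ ε : ℝ) (ω : Coins n ℓ β δ ε) : Set (PolyCurve d) :=
  ⋃ A : Subsample ℓ β δ ε,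
    let Y : {j // j ∈ A.1} → PolyCurve d := fun j => T (ω.1 j)
    subsampleCandidates n ℓ (sampleSize ℓ β δ ε) δ (ε / 6) Y
      (median34 simplify argmin Y (δ / 4) (ω.2 A))

/-!
The proof compares the candidates with a curve `b` of complexity at most `ℓ` whose cost on
`X = T'` is within a factor `1 + ε / 12` of the infimum (`exists_isApproxMedian`); existence of
an optimal median is not needed. Write `ε' = ε / 6` and let `M` be the mean distance of the members
of `X` to `b`.

*Geometry.* Fix nearly optimal matchings between `b` and the members of `X`. For a sample of `X`,
replace the part of `b` around each inner vertex, from the last vertex of a sampled curve matched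
before it to the first one matched after it, by a segment. The distance to a curve of `X` does
not increase if that curve has no vertex matched inside the parts replaced, which holds for the
sampled curves, and for all curves of `X` but a fraction `ε' / 2` provided that the sample hits the
top quantile of each of `2ℓ - 4` scores (`PolyCurve.exists_shortcut`, `prob_exceed_le`). The few
exceptional curves are charged to a sampled curve within `2 * M` of `b`, which gives
an additional cost of `2 * ε'` times that of `b` (`meanDist_le_of_prob_exceed_le`). The vertices of
the resulting curve are close to vertices of sampled curves, so that they can be rounded to the
grids, whose width is controlled by Markov's inequality and by the guarantee
`prob_median34_le` for the curve `c` that the algorithm computes for the sample.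

*The radius of the grids.* If `b` is far from the sample compared to `Δ`, then all sampled curves
are much closer to `c` than `b` is. Since `c` is the simplification of one sampled curve, the other
ones form a sample independent of `c`, so that most of `X` is close to `c`
(`prob_exists_missed_le`); but then `c` is at least as good as `b` (`meanDist_le_of_prob_far_le`).
These deterministic consequences of a good sample are collected in
`exists_mem_subsampleCandidates`.

*Probability.* With overwhelming probability at least `|S| / (2β)` positions of `S` hold members of
`T'` (`prob_card_hits_le_le`). Given which positions these are, the members at a subset of them are
independent and uniform in `T'`, by an involution that resamples them (`prob_and_resample`). Hence
one of the subsets considered by the algorithm is a uniform sample of `T'`, and the failure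
probabilities add up to at most `δ`.
-/

/-! ### Parametrized curves and the Fréchet distance -/

namespace PolyCurve

variable {d : ℕ}

/-- The parametrization of a polygonal curve as a function on all of `ℝ`; it is constant to the
left of `0` and to the right of `1`. -/
noncomputable def ev (τ : PolyCurve d) (t : ℝ) : Pt d :=
  τ.vertex 0 + ∑ i : Fin τ.edges, τ.progress i t • (τ.vertex i.succ - τ.vertex i.castSucc)

theorem toCurve_apply (τ : PolyCurve d) (t : unitInterval) : τ.toCurve t = τ.ev t := rfl

end PolyCurve

theorem exists_castSucc_le_lt_succ {M : ℕ} (x : Fin (M + 1) → ℝ) {t : ℝ} (h0 : x 0 ≤ t)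
    (h1 : t < x (Fin.last M)) : ∃ i : Fin M, x i.castSucc ≤ t ∧ t < x i.succ := by
  by_contra! hcon
  have : ∀ i, x i ≤ t := fun i => Fin.induction h0 hcon i
  exact absurd (this _) (not_le.2 h1)

theorem exists_castSucc_le_le_succ {M : ℕ} (x : Fin (M + 1) → ℝ) {t : ℝ} (hM : x 0 < x (Fin.last M))
    (h0 : x 0 ≤ t) (h1 : t ≤ x (Fin.last M)) : ∃ i : Fin M, x i.castSucc ≤ t ∧ t ≤ x i.succ := by
  rcases h1.lt_or_eq with h | h
  · obtain ⟨i, hi, hi'⟩ := exists_castSucc_le_lt_succ x h0 h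
    exact ⟨i, hi, hi'.le⟩
  · cases M with
    | zero => exact absurd hM (by simp)
    | succ M =>
      by_cases hx : x (Fin.last M).castSucc ≤ t
      · exact ⟨Fin.last M, hx, by rw [h, Fin.succ_last]⟩
      · push Not at hx
        obtain ⟨i, hi, hi'⟩ := exists_castSucc_le_lt_succ (fun i : Fin (M + 1) => x i.castSucc)
          (by simpa using h0) hx
        exact ⟨i.castSucc, hi, by rw [Fin.succ_castSucc]; exact hi'.le⟩

namespace PolyCurve

variable {d : ℕ}

theorem instant_mem (τ : PolyCurve d) (i : Fin (τ.edges + 1)) :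
    τ.instant i ∈ Set.Icc (0 : ℝ) 1 := by
  constructor
  · rw [← τ.instant_zero]; exact τ.instant_strictMono.monotone (Fin.zero_le i)
  · rw [← τ.instant_last]; exact τ.instant_strictMono.monotone (Fin.le_last i)

theorem ev_eq_lineMap (τ : PolyCurve d) (i : Fin τ.edges) {t : ℝ}
    (h₁ : τ.instant i.castSucc ≤ t) (h₂ : t ≤ τ.instant i.succ) :
    τ.ev t = AffineMap.lineMap (τ.vertex i.castSucc) (τ.vertex i.succ)
      ((t - τ.instant i.castSucc) / (τ.instant i.succ - τ.instant i.castSucc)) :=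
  τ.toCurve_eq_lineMap i
    ⟨t, (τ.instant_mem _).1.trans h₁, h₂.trans (τ.instant_mem _).2⟩ h₁ h₂

theorem exists_edge (τ : PolyCurve d) {t : ℝ} (h0 : 0 ≤ t) (h1 : t ≤ 1) :
    ∃ i : Fin τ.edges, τ.instant i.castSucc ≤ t ∧ t ≤ τ.instant i.succ :=
  exists_castSucc_le_le_succ τ.instant (by rw [τ.instant_zero, τ.instant_last]; exact one_pos)
    (by rwa [τ.instant_zero]) (by rwa [τ.instant_last])

theorem ev_castSucc (τ : PolyCurve d) (i : Fin τ.edges) :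
    τ.ev (τ.instant i.castSucc) = τ.vertex i.castSucc := by
  rw [τ.ev_eq_lineMap i le_rfl (τ.instant_strictMono i.castSucc_lt_succ).le]
  simp

theorem ev_succ (τ : PolyCurve d) (i : Fin τ.edges) :
    τ.ev (τ.instant i.succ) = τ.vertex i.succ := by
  have h := τ.instant_strictMono i.castSucc_lt_succ
  rw [τ.ev_eq_lineMap i h.le le_rfl, div_self (sub_pos.2 h).ne']
  simp

theorem edges_pos (τ : PolyCurve d) : 0 < τ.edges := by
  obtain ⟨i, -⟩ := τ.exists_edge le_rfl zero_le_one
  exact i.pos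

theorem ev_instant (τ : PolyCurve d) (i : Fin (τ.edges + 1)) :
    τ.ev (τ.instant i) = τ.vertex i := by
  rcases Fin.eq_zero_or_eq_succ i with rfl | ⟨j, rfl⟩
  · exact τ.ev_castSucc ⟨0, τ.edges_pos⟩
  · exact τ.ev_succ j

/-- A polygonal curve is affine on an interval whose interior contains none of its instants. -/
theorem ev_eq_lineMap_of_notMem (τ : PolyCurve d) {a b t : ℝ} (h0 : 0 ≤ a) (h1 : b ≤ 1)
    (hab : a < b) (hno : ∀ j, τ.instant j ∉ Set.Ioo a b) (ha : a ≤ t) (hb : t ≤ b) :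
    τ.ev t = AffineMap.lineMap (τ.ev a) (τ.ev b) ((t - a) / (b - a)) := by
  obtain ⟨i, hi, hi'⟩ := exists_castSucc_le_lt_succ τ.instant (t := a)
    (by rwa [τ.instant_zero]) (by rw [τ.instant_last]; linarith)
  have hbi : b ≤ τ.instant i.succ := by
    by_contra! h
    exact hno _ ⟨hi', h⟩
  rw [τ.ev_eq_lineMap i (hi.trans ha) (hb.trans hbi), τ.ev_eq_lineMap i hi hi'.le,
    τ.ev_eq_lineMap i (hi.trans hab.le) hbi, ← AffineMap.apply_lineMap]
  congr 1
  have hpos := sub_pos.2 (τ.instant_strictMono i.castSucc_lt_succ)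
  have hpos' := sub_pos.2 hab
  rw [AffineMap.lineMap_apply_ring']
  field_simp
  ring

theorem progress_mono (τ : PolyCurve d) (i : Fin τ.edges) : Monotone (τ.progress i) := by
  intro s t hst
  have hpos := sub_pos.2 (τ.instant_strictMono i.castSucc_lt_succ)
  unfold progress
  gcongr

theorem progress_lt (τ : PolyCurve d) (i : Fin τ.edges) {s t : ℝ} (hst : s < t)
    (h₁ : τ.instant i.castSucc ≤ s) (h₂ : s < τ.instant i.succ) :
    τ.progress i s < τ.progress i t := by
  have hpos := sub_pos.2 (τ.instant_strictMono i.castSucc_lt_succ)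
  have hs0 : 0 ≤ (s - τ.instant i.castSucc) / (τ.instant i.succ - τ.instant i.castSucc) :=
    div_nonneg (by linarith) hpos.le
  have hs1 : (s - τ.instant i.castSucc) / (τ.instant i.succ - τ.instant i.castSucc) < 1 := by
    rw [div_lt_one hpos]; linarith
  have hst' : (s - τ.instant i.castSucc) / (τ.instant i.succ - τ.instant i.castSucc) <
      (t - τ.instant i.castSucc) / (τ.instant i.succ - τ.instant i.castSucc) := by
    gcongr
  unfold progress
  rw [min_eq_right hs1.le, max_eq_right hs0]
  exact lt_max_of_lt_right (lt_min hs1 hst')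

end PolyCurve

namespace Reparam

theorem id_mem : ContinuousMap.id unitInterval ∈ Reparam :=
  ⟨Function.bijective_id, rfl, rfl⟩

instance : Nonempty Reparam := ⟨⟨_, id_mem⟩⟩

theorem comp_mem {g h : C(unitInterval, unitInterval)} (hg : g ∈ Reparam) (hh : h ∈ Reparam) :
    g.comp h ∈ Reparam :=
  ⟨hg.1.comp hh.1, by simp [hh.2.1, hg.2.1], by simp [hh.2.2, hg.2.2]⟩

theorem exists_inverse {h : C(unitInterval, unitInterval)} (hh : h ∈ Reparam) :
    ∃ g ∈ Reparam, (∀ t, h (g t) = t) ∧ ∀ t, g (h t) = t := by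
  let e := Continuous.homeoOfEquivCompactToT2 (f := Equiv.ofBijective h hh.1) h.continuous
  have h1 : ∀ t, h (e.symm t) = t := fun t => e.apply_symm_apply t
  have h2 : ∀ t, e.symm (h t) = t := fun t => e.symm_apply_apply t
  refine ⟨⟨e.symm, e.symm.continuous⟩, ⟨e.symm.bijective, ?_, ?_⟩, h1, h2⟩
  · have := h2 0
    rwa [hh.2.1] at this
  · have := h2 1
    rwa [hh.2.2] at this

theorem strictMono {h : C(unitInterval, unitInterval)} (hh : h ∈ Reparam) : StrictMono h := by
  apply Continuous.strictMono_of_inj_boundedOrder h.continuous _ hh.1.1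
  change h 0 ≤ h 1
  rw [hh.2.1, hh.2.2]
  exact zero_le_one

end Reparam

section Frechet

variable {d : ℕ}

theorem frechetDist_le {σ τ : PolyCurve d} {r : ℝ} {h : C(unitInterval, unitInterval)}
    (hh : h ∈ Reparam) (hr : ∀ t, ‖σ.toCurve t - τ.toCurve (h t)‖ ≤ r) : frechetDist σ τ ≤ r := by
  refine ciInf_le_of_le ⟨0, ?_⟩ (⟨h, hh⟩ : Reparam) (ciSup_le hr)
  rintro _ ⟨g, rfl⟩
  exact Real.iSup_nonneg fun _ => norm_nonneg _

theorem exists_reparam_of_frechetDist_lt {σ τ : PolyCurve d} {r : ℝ} (hr : frechetDist σ τ < r) :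
    ∃ h ∈ Reparam, ∀ t, ‖σ.toCurve t - τ.toCurve (h t)‖ ≤ r := by
  obtain ⟨⟨h, hh⟩, hlt⟩ := exists_lt_of_ciInf_lt hr
  refine ⟨h, hh, fun t => le_trans (le_ciSup (f := fun t => ‖σ.toCurve t - τ.toCurve (h t)‖)
    ?_ t) hlt.le⟩
  exact (isCompact_range (by fun_prop)).bddAbove

theorem frechetDist_nonneg (σ τ : PolyCurve d) : 0 ≤ frechetDist σ τ :=
  Real.iInf_nonneg fun _ => Real.iSup_nonneg fun _ => norm_nonneg _

theorem frechetDist_comm_le (σ τ : PolyCurve d) : frechetDist τ σ ≤ frechetDist σ τ := by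
  refine le_of_forall_gt_imp_ge_of_dense fun r hr => ?_
  obtain ⟨h, hh, hle⟩ := exists_reparam_of_frechetDist_lt hr
  obtain ⟨g, hg, hhg, -⟩ := Reparam.exists_inverse hh
  refine frechetDist_le hg fun t => ?_
  have := hle (g t)
  rwa [hhg, norm_sub_rev] at this

theorem frechetDist_comm (σ τ : PolyCurve d) : frechetDist σ τ = frechetDist τ σ :=
  le_antisymm (frechetDist_comm_le _ _) (frechetDist_comm_le _ _)

theorem frechetDist_triangle (ρ σ τ : PolyCurve d) :
    frechetDist ρ τ ≤ frechetDist ρ σ + frechetDist σ τ := by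
  refine le_of_forall_pos_le_add fun e he => ?_
  obtain ⟨g, hg, hgle⟩ := exists_reparam_of_frechetDist_lt
    (lt_add_of_pos_right (frechetDist ρ σ) (half_pos he))
  obtain ⟨h, hh, hhle⟩ := exists_reparam_of_frechetDist_lt
    (lt_add_of_pos_right (frechetDist σ τ) (half_pos he))
  refine frechetDist_le (Reparam.comp_mem hh hg) fun t => ?_
  have h1 := hgle t
  have h2 := hhle (g t)
  have h3 := norm_sub_le_norm_sub_add_norm_sub (ρ.toCurve t) (σ.toCurve (g t))
    (τ.toCurve (h (g t)))
  simp only [ContinuousMap.comp_apply]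
  linarith

theorem norm_lineMap_sub_lineMap_le {E : Type*} [NormedAddCommGroup E] [NormedSpace ℝ E]
    {p q p' q' : E} {r s : ℝ} (hs0 : 0 ≤ s) (hs1 : s ≤ 1) (hp : ‖p - p'‖ ≤ r)
    (hq : ‖q - q'‖ ≤ r) :
    ‖AffineMap.lineMap p q s - AffineMap.lineMap p' q' s‖ ≤ r := by
  have : (AffineMap.lineMap p q s - AffineMap.lineMap p' q' s : E) =
      (1 - s) • (p - p') + s • (q - q') := by
    simp only [AffineMap.lineMap_apply_module]
    module
  rw [this]
  calc _ ≤ ‖(1 - s) • (p - p')‖ + ‖s • (q - q')‖ := norm_add_le _ _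
    _ = (1 - s) * ‖p - p'‖ + s * ‖q - q'‖ := by
      rw [norm_smul, norm_smul, Real.norm_of_nonneg hs0, Real.norm_of_nonneg (sub_nonneg.2 hs1)]
    _ ≤ (1 - s) * r + s * r := by
      have := sub_nonneg.2 hs1
      gcongr
    _ = r := by ring

/-- Curves with the same instants are no farther apart than their vertices. -/
theorem frechetDist_le_of_vertex {m : ℕ} {v w : Fin (m + 1) → Pt d} {x : Fin (m + 1) → ℝ}
    (hx : StrictMono x) (h0 : x 0 = 0) (h1 : x (Fin.last m) = 1) {r : ℝ}
    (hr : ∀ i, ‖v i - w i‖ ≤ r) :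
    frechetDist ⟨m, v, x, hx, h0, h1⟩ ⟨m, w, x, hx, h0, h1⟩ ≤ r := by
  refine frechetDist_le Reparam.id_mem fun t => ?_
  set σ : PolyCurve d := ⟨m, v, x, hx, h0, h1⟩
  set τ : PolyCurve d := ⟨m, w, x, hx, h0, h1⟩
  obtain ⟨i, hi, hi'⟩ := σ.exists_edge t.2.1 t.2.2
  rw [ContinuousMap.id_apply, σ.toCurve_eq_lineMap i t hi hi', τ.toCurve_eq_lineMap i t hi hi']
  have hpos := sub_pos.2 (σ.instant_strictMono i.castSucc_lt_succ)
  refine norm_lineMap_sub_lineMap_le (div_nonneg (sub_nonneg.2 hi) hpos.le) ?_ (hr _) (hr _)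
  rw [div_le_one hpos]
  linarith

/-- The piecewise affine reparametrization through prescribed values. -/
theorem exists_reparam_interpolating {M : ℕ} {x y : Fin (M + 1) → ℝ} (hx : StrictMono x)
    (hy : StrictMono y) (hx0 : x 0 = 0) (hx1 : x (Fin.last M) = 1) (hy0 : y 0 = 0)
    (hy1 : y (Fin.last M) = 1) :
    ∃ h ∈ Reparam, ∀ (i : Fin M) (t : unitInterval), x i.castSucc ≤ t → t ≤ x i.succ →
      (h t : ℝ) = AffineMap.lineMap (y i.castSucc) (y i.succ)
        ((t - x i.castSucc) / (x i.succ - x i.castSucc)) := by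
  -- The graph is the coordinate of a polygonal curve on the line.
  let Z : PolyCurve 1 := ⟨M, fun i => WithLp.toLp 2 fun _ => y i, x, hx, hx0, hx1⟩
  let H : ℝ → ℝ := fun t => Z.ev t 0
  have hH : ∀ t, H t = ∑ i : Fin M, Z.progress i t * (y i.succ - y i.castSucc) := by
    intro t
    simp only [H, PolyCurve.ev, PiLp.add_apply, WithLp.ofLp_sum, Finset.sum_apply,
      PiLp.smul_apply, PiLp.sub_apply, smul_eq_mul]
    simp [Z, hy0]
  have hHmono : ∀ s t, 0 ≤ s → s < t → t ≤ 1 → H s < H t := by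
    intro s t hs hst ht
    obtain ⟨i, hi, hi'⟩ := exists_castSucc_le_lt_succ x (t := s) (by rwa [hx0])
      (by rw [hx1]; linarith)
    rw [hH, hH]
    refine Finset.sum_lt_sum (fun j _ => ?_) ⟨i, Finset.mem_univ _, ?_⟩
    · exact mul_le_mul_of_nonneg_right (Z.progress_mono j hst.le)
        (sub_pos.2 (hy j.castSucc_lt_succ)).le
    · exact mul_lt_mul_of_pos_right (Z.progress_lt i hst hi hi') (sub_pos.2 (hy i.castSucc_lt_succ))
  have hH0 : H 0 = 0 := by
    have := Z.ev_instant 0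
    rw [Z.instant_zero] at this
    simp [H, this, Z, hy0]
  have hH1 : H 1 = 1 := by
    have := Z.ev_instant (Fin.last M)
    rw [Z.instant_last] at this
    simp [H, this, Z, hy1]
  have hle : ∀ s t, 0 ≤ s → s ≤ t → t ≤ 1 → H s ≤ H t := by
    intro s t hs hst ht
    rcases hst.lt_or_eq with h | rfl
    · exact (hHmono s t hs h ht).le
    · exact le_rfl
  have hmem : ∀ t : unitInterval, H t ∈ Set.Icc (0 : ℝ) 1 := fun t =>
    ⟨hH0 ▸ hle 0 t le_rfl t.2.1 t.2.2, hH1 ▸ hle t 1 t.2.1 t.2.2 le_rfl⟩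
  have hcont : Continuous fun t : unitInterval => H t := by
    have : Continuous fun t : unitInterval => Z.toCurve t 0 := by fun_prop
    exact this
  let h : C(unitInterval, unitInterval) := ⟨fun t => ⟨H t, hmem t⟩, hcont.subtype_mk _⟩
  have h0 : h 0 = 0 := Subtype.ext hH0
  have h1 : h 1 = 1 := Subtype.ext hH1
  have hsm : StrictMono h := fun s t hst => hHmono s t s.2.1 hst t.2.2
  refine ⟨h, ⟨⟨hsm.injective, ?_⟩, h0, h1⟩, fun i t hi hi' => ?_⟩
  · intro z
    have := intermediate_value_univ (0 : unitInterval) 1 h.continuous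
    rw [h0, h1] at this
    exact this ⟨z.2.1, z.2.2⟩
  · change Z.ev t 0 = _
    rw [Z.ev_eq_lineMap i hi hi']
    simp [Z, AffineMap.lineMap_apply]

/-- Two polygonal curves are within `r` if `[0,1]` can be subdivided for each of them into equally
many pieces, on which they are affine, with corresponding subdivision points within `r`. -/
theorem frechetDist_le_of_subdivision {σ τ : PolyCurve d} {M : ℕ} {x y : Fin (M + 1) → ℝ}
    (hx : StrictMono x) (hy : StrictMono y) (hx0 : x 0 = 0) (hx1 : x (Fin.last M) = 1)
    (hy0 : y 0 = 0) (hy1 : y (Fin.last M) = 1) {r : ℝ}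
    (hσ : ∀ (i : Fin M) j, σ.instant j ∉ Set.Ioo (x i.castSucc) (x i.succ))
    (hτ : ∀ (i : Fin M) j, τ.instant j ∉ Set.Ioo (y i.castSucc) (y i.succ))
    (hr : ∀ i, ‖σ.ev (x i) - τ.ev (y i)‖ ≤ r) : frechetDist σ τ ≤ r := by
  obtain ⟨h, hh, hlin⟩ := exists_reparam_interpolating hx hy hx0 hx1 hy0 hy1
  refine frechetDist_le hh fun t => ?_
  obtain ⟨i, hi, hi'⟩ := exists_castSucc_le_le_succ x (t := t) (by rw [hx0, hx1]; exact one_pos)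
    (by rw [hx0]; exact t.2.1) (by rw [hx1]; exact t.2.2)
  have hxi : ∀ i, 0 ≤ x i ∧ x i ≤ 1 := fun i =>
    ⟨hx0 ▸ hx.monotone (Fin.zero_le i), hx1 ▸ hx.monotone (Fin.le_last i)⟩
  have hyi : ∀ i, 0 ≤ y i ∧ y i ≤ 1 := fun i =>
    ⟨hy0 ▸ hy.monotone (Fin.zero_le i), hy1 ▸ hy.monotone (Fin.le_last i)⟩
  have hxpos := sub_pos.2 (hx i.castSucc_lt_succ)
  have hypos := sub_pos.2 (hy i.castSucc_lt_succ)
  set s := ((t : ℝ) - x i.castSucc) / (x i.succ - x i.castSucc) with hs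
  have hs0 : 0 ≤ s := div_nonneg (sub_nonneg.2 hi) hxpos.le
  have hs1 : s ≤ 1 := by rw [hs, div_le_one hxpos]; linarith
  have hht : (h t : ℝ) = y i.castSucc + s * (y i.succ - y i.castSucc) := by
    rw [hlin i t hi hi', AffineMap.lineMap_apply_ring']
    ring
  have hsy : ((h t : ℝ) - y i.castSucc) / (y i.succ - y i.castSucc) = s := by
    rw [hht]; field_simp; ring
  rw [PolyCurve.toCurve_apply, PolyCurve.toCurve_apply,
    σ.ev_eq_lineMap_of_notMem (hxi _).1 (hxi _).2 (hx i.castSucc_lt_succ) (hσ i) hi hi',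
    τ.ev_eq_lineMap_of_notMem (hyi _).1 (hyi _).2 (hy i.castSucc_lt_succ) (hτ i)
      (by rw [hht]; nlinarith) (by rw [hht]; nlinarith), hsy]
  exact norm_lineMap_sub_lineMap_le hs0 hs1 (hr _) (hr _)

end Frechet

/-! ### Shortcutting -/

namespace PolyCurve

variable {d : ℕ}

/-- The polygonal curve inscribed in `γ` whose instants are the elements of `Q`. -/
noncomputable def inscribe (γ : PolyCurve d) (Q : Finset ℝ) (h0 : 0 ∈ Q) (h1 : 1 ∈ Q)
    (hQ : ∀ x ∈ Q, x ∈ Set.Icc (0 : ℝ) 1) : PolyCurve d :=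
  have hcard : Q.card = Q.card - 1 + 1 := (Nat.sub_add_cancel (Finset.card_pos.2 ⟨0, h0⟩)).symm
  { edges := Q.card - 1
    vertex := fun i => γ.ev (Q.orderEmbOfFin hcard i)
    instant := Q.orderEmbOfFin hcard
    instant_strictMono := (Q.orderEmbOfFin hcard).strictMono
    instant_zero := by
      have := Finset.orderEmbOfFin_zero hcard (Nat.succ_pos _)
      refine Eq.trans this (le_antisymm (Finset.min'_le _ _ h0) ?_)
      exact Finset.le_min' _ _ _ fun x hx => (hQ x hx).1
    instant_last := by
      have := Finset.orderEmbOfFin_last hcard (Nat.succ_pos _)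
      refine Eq.trans this (le_antisymm ?_ (Finset.le_max' _ _ h1))
      exact Finset.max'_le _ _ _ fun x hx => (hQ x hx).2 }

variable {γ : PolyCurve d} {Q : Finset ℝ} {h0 : 0 ∈ Q} {h1 : 1 ∈ Q}
  {hQ : ∀ x ∈ Q, x ∈ Set.Icc (0 : ℝ) 1}

theorem inscribe_complexity : (γ.inscribe Q h0 h1 hQ).complexity = Q.card :=
  Nat.sub_add_cancel (Finset.card_pos.2 ⟨0, h0⟩)

theorem inscribe_instant_mem (i) : (γ.inscribe Q h0 h1 hQ).instant i ∈ Q :=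
  Finset.orderEmbOfFin_mem _ _ i

theorem inscribe_vertex (i) : (γ.inscribe Q h0 h1 hQ).vertex i =
    γ.ev ((γ.inscribe Q h0 h1 hQ).instant i) := rfl

theorem exists_inscribe_instant {x : ℝ} (hx : x ∈ Q) :
    ∃ i, (γ.inscribe Q h0 h1 hQ).instant i = x := by
  have hcard : Q.card = Q.card - 1 + 1 := (Nat.sub_add_cancel (Finset.card_pos.2 ⟨0, h0⟩)).symm
  have : x ∈ Set.range (Q.orderEmbOfFin hcard) := by
    rw [Finset.range_orderEmbOfFin]; exact hx
  exact this

theorem inscribe_ev_of_mem {x : ℝ} (hx : x ∈ Q) : (γ.inscribe Q h0 h1 hQ).ev x = γ.ev x := by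
  obtain ⟨i, rfl⟩ := exists_inscribe_instant (γ := γ) (h0 := h0) (h1 := h1) (hQ := hQ) hx
  rw [ev_instant, inscribe_vertex]

/-- Two consecutive instants are neighbours in the image. -/
theorem notMem_Ioo_instant (τ : PolyCurve d) (i : Fin τ.edges) (j) :
    τ.instant j ∉ Set.Ioo (τ.instant i.castSucc) (τ.instant i.succ) := by
  rintro ⟨h, h'⟩
  have h := τ.instant_strictMono.lt_iff_lt.1 h
  have h' := τ.instant_strictMono.lt_iff_lt.1 h'
  rw [Fin.lt_def] at h h'
  simp only [Fin.val_castSucc, Fin.val_succ] at h h'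
  omega

/-- Where `γ` has no instants between consecutive points of `Q`, nothing is changed. -/
theorem inscribe_ev_of_notMem (i : Fin (γ.inscribe Q h0 h1 hQ).edges) {t : ℝ}
    (hno : ∀ j, γ.instant j ∉ Set.Ioo ((γ.inscribe Q h0 h1 hQ).instant i.castSucc)
      ((γ.inscribe Q h0 h1 hQ).instant i.succ))
    (ha : (γ.inscribe Q h0 h1 hQ).instant i.castSucc ≤ t)
    (hb : t ≤ (γ.inscribe Q h0 h1 hQ).instant i.succ) :
    (γ.inscribe Q h0 h1 hQ).ev t = γ.ev t := by
  rw [ev_eq_lineMap_of_notMem γ (instant_mem _ _).1 (instant_mem _ _).2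
    (instant_strictMono _ i.castSucc_lt_succ) hno ha hb, ev_eq_lineMap _ i ha hb]
  rfl

/-- Shortcutting does not increase the distance to `τ`, if every shortcut of `γ` is matched
to a part of a single edge of `τ`. -/
theorem frechetDist_inscribe_le {τ : PolyCurve d} {r : ℝ} {h : C(unitInterval, unitInterval)}
    (hh : h ∈ Reparam) (hr : ∀ t, ‖τ.toCurve t - γ.toCurve (h t)‖ ≤ r) (D : Finset ℝ)
    (hD : ∀ j, ∃ t : unitInterval, (t : ℝ) = τ.instant j ∧ (h t : ℝ) ∈ D)
    (hD' : ∀ x ∈ D, x ∈ Set.Icc (0 : ℝ) 1)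
    (hgap : ∀ i : Fin (γ.inscribe Q h0 h1 hQ).edges,
      (∀ j, γ.instant j ∉ Set.Ioo ((γ.inscribe Q h0 h1 hQ).instant i.castSucc)
        ((γ.inscribe Q h0 h1 hQ).instant i.succ)) ∨
      ∀ x ∈ D, x ∉ Set.Ioo ((γ.inscribe Q h0 h1 hQ).instant i.castSucc)
        ((γ.inscribe Q h0 h1 hQ).instant i.succ)) :
    frechetDist τ (γ.inscribe Q h0 h1 hQ) ≤ r := by
  classical
  obtain ⟨g, hg, hhg, hgh⟩ := Reparam.exists_inverse hh
  -- The common refinement of the instants of the two curves, in the time of `γ`.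
  have hU : ∀ x ∈ Q ∪ D, x ∈ Set.Icc (0 : ℝ) 1 := fun x hx =>
    (Finset.mem_union.1 hx).elim (hQ x) (hD' x)
  set ρ := γ.inscribe (Q ∪ D) (Finset.mem_union_left _ h0) (Finset.mem_union_left _ h1) hU with hρ
  set σ := γ.inscribe Q h0 h1 hQ with hσ
  have hρD : ∀ x ∈ Q ∪ D, ∀ i : Fin ρ.edges,
      x ∉ Set.Ioo (ρ.instant i.castSucc) (ρ.instant i.succ) := by
    intro x hx i
    obtain ⟨j, rfl⟩ := exists_inscribe_instant (γ := γ) (h0 := Finset.mem_union_left _ h0)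
      (h1 := Finset.mem_union_left _ h1) (hQ := hU) hx
    exact ρ.notMem_Ioo_instant i j
  let z : Fin (ρ.edges + 1) → unitInterval := fun i => ⟨ρ.instant i, ρ.instant_mem i⟩
  have hz : StrictMono z := fun i j hij => ρ.instant_strictMono hij
  have hgm := Reparam.strictMono hg
  have hhm := Reparam.strictMono hh
  rw [frechetDist_comm]
  refine frechetDist_le_of_subdivision (x := ρ.instant) (y := fun i => (g (z i) : ℝ))
    ρ.instant_strictMono (fun i j hij => hgm (hz hij)) ρ.instant_zero ρ.instant_last ?_ ?_ ?_ ?_ ?_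
  · have : z 0 = 0 := Subtype.ext ρ.instant_zero
    simp [this, hg.2.1]
  · have : z (Fin.last _) = 1 := Subtype.ext ρ.instant_last
    simp [this, hg.2.2]
  · exact fun i j => hρD _ (Finset.mem_union_left _ (inscribe_instant_mem j)) i
  · rintro i j ⟨hj, hj'⟩
    obtain ⟨t, ht, htD⟩ := hD j
    rw [← ht] at hj hj'
    have e1 : h (g (z i.castSucc)) < h t := hhm hj
    have e2 : h t < h (g (z i.succ)) := hhm hj'
    rw [hhg] at e1 e2
    exact hρD _ (Finset.mem_union_right _ htD) i ⟨e1, e2⟩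
  · intro i
    have hσγ : σ.ev (ρ.instant i) = γ.ev (ρ.instant i) := by
      by_cases hi : ρ.instant i ∈ Q
      · exact inscribe_ev_of_mem hi
      · obtain ⟨k, hk, hk'⟩ := σ.exists_edge (ρ.instant_mem i).1 (ρ.instant_mem i).2
        refine inscribe_ev_of_notMem k ((hgap k).resolve_right fun hno => ?_) hk hk'
        refine hno _ ((Finset.mem_union.1 (inscribe_instant_mem i)).resolve_left hi) ⟨?_, ?_⟩
        · exact lt_of_le_of_ne hk fun e => hi (e ▸ inscribe_instant_mem _)
        · exact lt_of_le_of_ne hk' fun e => hi (e ▸ inscribe_instant_mem _)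
    have := hr (g (z i))
    rw [hhg, norm_sub_rev] at this
    rwa [hσγ]

/-- The instants of a curve other than the first and the last one, as indices. -/
abbrev Interior (γ : PolyCurve d) := {i : Fin (γ.edges + 1) // i ≠ 0 ∧ i ≠ Fin.last γ.edges}

theorem card_interior (γ : PolyCurve d) : Fintype.card γ.Interior = γ.complexity - 2 := by
  classical
  have : Fintype.card γ.Interior =
      (((Finset.univ : Finset (Fin (γ.edges + 1))).erase 0).erase (Fin.last γ.edges)).card := by
    rw [Fintype.card_subtype]
    congr 1
    ext i
    simp [and_comm]
  rw [this, Finset.card_erase_of_mem, Finset.card_erase_of_mem (Finset.mem_univ _)]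
  · simp [complexity]
  · simp [Fin.ext_iff, γ.edges_pos.ne']

/-- **Simultaneous shortcutting.** For curves `X k` within less than `r k` of `γ`, there are
`2|γ| - 4` real-valued scores such that every nonempty subfamily `X ∘ u` gives rise to a curve of
complexity at most `2|γ| - 2`, with vertices near vertices of the subfamily, which is within `r k`
of every `X k` none of whose scores exceeds those of the whole subfamily. The scores of `X k` are
the position of the last vertex matched before (up to sign: of the first vertex matched after) an
inner vertex of `γ`, so that the shortcuts for the subfamily are the shortest possible. -/
theorem exists_shortcut (γ : PolyCurve d) {κ : Type} (X : κ → PolyCurve d) (r : κ → ℝ)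
    (hr : ∀ k, frechetDist (X k) γ < r k) :
    ∃ score : γ.Interior × Bool → κ → ℝ, ∀ (ι : Type) [Fintype ι] [Nonempty ι] (u : ι → κ),
      ∃ σ : PolyCurve d, σ.complexity ≤ 2 * γ.complexity - 2 ∧
        (∀ i, ∃ a j, ‖σ.vertex i - (X (u a)).vertex j‖ ≤ r (u a)) ∧
        ∀ k, (∀ b, ∃ a, score b k ≤ score b (u a)) → frechetDist (X k) σ ≤ r k := by
  classical
  choose h hh hle using fun k => exists_reparam_of_frechetDist_lt (hr k)
  let z : ∀ k, Fin ((X k).edges + 1) → unitInterval := fun k j =>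
    ⟨(X k).instant j, (X k).instant_mem j⟩
  -- The times of `γ` that are matched to the vertices of `X k`.
  let D : κ → Finset ℝ := fun k => Finset.univ.image fun j => (h k (z k j) : ℝ)
  have hD0 : ∀ k, 0 ∈ D k := fun k => Finset.mem_image.2 ⟨0, Finset.mem_univ _, by
    have : z k 0 = 0 := Subtype.ext (X k).instant_zero
    simp [this, (hh k).2.1]⟩
  have hD1 : ∀ k, 1 ∈ D k := fun k => Finset.mem_image.2 ⟨Fin.last _, Finset.mem_univ _, by
    have : z k (Fin.last _) = 1 := Subtype.ext (X k).instant_last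
    simp [this, (hh k).2.2]⟩
  have hDI : ∀ k, ∀ x ∈ D k, x ∈ Set.Icc (0 : ℝ) 1 := by
    intro k x hx
    obtain ⟨j, -, rfl⟩ := Finset.mem_image.1 hx
    exact (h k (z k j)).2
  have hDv : ∀ k, ∀ x ∈ D k, ∃ j, ‖γ.ev x - (X k).vertex j‖ ≤ r k := by
    intro k x hx
    obtain ⟨j, -, rfl⟩ := Finset.mem_image.1 hx
    refine ⟨j, ?_⟩
    have := hle k (z k j)
    rw [norm_sub_rev] at this
    rwa [← (X k).ev_instant j]
  have hlo : ∀ k i, ∃ x ∈ D k, x ≤ γ.instant i ∧ ∀ y ∈ D k, y ≤ γ.instant i → y ≤ x := by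
    intro k i
    obtain ⟨x, hx, hmax⟩ := ((D k).filter (· ≤ γ.instant i)).exists_max_image id
      ⟨0, Finset.mem_filter.2 ⟨hD0 k, (γ.instant_mem i).1⟩⟩
    rw [Finset.mem_filter] at hx
    exact ⟨x, hx.1, hx.2, fun y hy hy' => hmax y (Finset.mem_filter.2 ⟨hy, hy'⟩)⟩
  have hhi : ∀ k i, ∃ x ∈ D k, γ.instant i ≤ x ∧ ∀ y ∈ D k, γ.instant i ≤ y → x ≤ y := by
    intro k i
    obtain ⟨x, hx, hmin⟩ := ((D k).filter (γ.instant i ≤ ·)).exists_min_image id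
      ⟨1, Finset.mem_filter.2 ⟨hD1 k, (γ.instant_mem i).2⟩⟩
    rw [Finset.mem_filter] at hx
    exact ⟨x, hx.1, hx.2, fun y hy hy' => hmin y (Finset.mem_filter.2 ⟨hy, hy'⟩)⟩
  choose lo hloD hlole hlomax using hlo
  choose hi hhiD hhile himin using hhi
  refine ⟨fun b k => if b.2 then lo k b.1 else -hi k b.1, fun ι _ _ u => ?_⟩
  have hp : ∀ i, ∃ a, ∀ a', lo (u a') i ≤ lo (u a) i := fun i =>
    Finite.exists_max fun a => lo (u a) i
  have hq : ∀ i, ∃ a, ∀ a', hi (u a) i ≤ hi (u a') i := fun i =>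
    Finite.exists_min fun a => hi (u a) i
  choose p hpmax using hp
  choose q hqmin using hq
  let Q : Finset ℝ := {0, 1} ∪ Finset.univ.image fun b : γ.Interior × Bool =>
    if b.2 then lo (u (p b.1)) b.1 else hi (u (q b.1)) b.1
  have hQp : ∀ i : γ.Interior, lo (u (p i)) i ∈ Q := fun i =>
    Finset.mem_union_right _ (Finset.mem_image.2 ⟨(i, true), Finset.mem_univ _, rfl⟩)
  have hQq : ∀ i : γ.Interior, hi (u (q i)) i ∈ Q := fun i =>
    Finset.mem_union_right _ (Finset.mem_image.2 ⟨(i, false), Finset.mem_univ _, rfl⟩)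
  have h0 : 0 ∈ Q := Finset.mem_union_left _ (by simp)
  have h1 : 1 ∈ Q := Finset.mem_union_left _ (by simp)
  have hQD : ∀ x ∈ Q, ∃ a, x ∈ D (u a) := by
    intro x hx
    rcases Finset.mem_union.1 hx with hx | hx
    · rcases Finset.mem_insert.1 hx with rfl | hx
      · exact ⟨Classical.arbitrary ι, hD0 _⟩
      · rw [Finset.mem_singleton.1 hx]
        exact ⟨Classical.arbitrary ι, hD1 _⟩
    · obtain ⟨⟨i, b⟩, -, rfl⟩ := Finset.mem_image.1 hx
      cases b
      · exact ⟨_, hhiD _ _⟩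
      · exact ⟨_, hloD _ _⟩
  have hQI : ∀ x ∈ Q, x ∈ Set.Icc (0 : ℝ) 1 := fun x hx =>
    (hQD x hx).elim fun a ha => hDI _ x ha
  refine ⟨γ.inscribe Q h0 h1 hQI, ?_, fun i => ?_, fun k hk => ?_⟩
  · rw [inscribe_complexity]
    have h2 : 2 ≤ γ.complexity := Nat.succ_le_succ γ.edges_pos
    calc Q.card ≤ 2 + Fintype.card (γ.Interior × Bool) :=
          (Finset.card_union_le _ _).trans (add_le_add Finset.card_le_two
            (Finset.card_image_le.trans_eq Finset.card_univ))
      _ ≤ 2 * γ.complexity - 2 := by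
        rw [Fintype.card_prod, card_interior, Fintype.card_bool]; omega
  · obtain ⟨a, ha⟩ := hQD _ (inscribe_instant_mem (γ := γ) (h0 := h0) (h1 := h1) (hQ := hQI) i)
    obtain ⟨j, hj⟩ := hDv _ _ ha
    exact ⟨a, j, hj⟩
  · refine frechetDist_inscribe_le (hh k) (hle k) (D k)
      (fun j => ⟨z k j, rfl, Finset.mem_image.2 ⟨j, Finset.mem_univ _, rfl⟩⟩) (hDI k) ?_
    set σ := γ.inscribe Q h0 h1 hQI
    intro e
    have hgapQ : ∀ x ∈ Q, x ∉ Set.Ioo (σ.instant e.castSucc) (σ.instant e.succ) := by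
      intro x hx
      obtain ⟨j, rfl⟩ := exists_inscribe_instant (γ := γ) (h0 := h0) (h1 := h1) (hQ := hQI) hx
      exact σ.notMem_Ioo_instant e j
    by_cases hγ : ∀ j, γ.instant j ∉ Set.Ioo (σ.instant e.castSucc) (σ.instant e.succ)
    · exact Or.inl hγ
    right
    push Not at hγ
    obtain ⟨i, hi1, hi2⟩ := hγ
    have hint : i ≠ 0 ∧ i ≠ Fin.last γ.edges := by
      constructor
      · rintro rfl
        rw [γ.instant_zero] at hi1
        exact (not_lt.2 (σ.instant_mem _).1) hi1
      · rintro rfl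
        rw [γ.instant_last] at hi2
        exact (not_lt.2 (σ.instant_mem _).2) hi2
    have hlo' : lo k i ≤ σ.instant e.castSucc := by
      obtain ⟨a, ha⟩ := hk (⟨i, hint⟩, true)
      simp only [if_true] at ha
      refine (ha.trans (hpmax i a)).trans ?_
      by_contra! hlt
      exact hgapQ _ (hQp ⟨i, hint⟩) ⟨hlt, (hlole _ _).trans_lt hi2⟩
    have hhi' : σ.instant e.succ ≤ hi k i := by
      obtain ⟨a, ha⟩ := hk (⟨i, hint⟩, false)
      simp only [Bool.false_eq_true, if_false, neg_le_neg_iff] at ha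
      refine le_trans ?_ ((hqmin i a).trans ha)
      by_contra! hlt
      exact hgapQ _ (hQq ⟨i, hint⟩) ⟨hi1.trans_le (hhile _ _), hlt⟩
    rintro x hx ⟨hx1, hx2⟩
    rcases le_total x (γ.instant i) with hle' | hle'
    · exact absurd ((hlomax k i x hx hle').trans hlo') (not_le.2 hx1)
    · exact absurd (hhi'.trans (himin k i x hx hle')) (not_le.2 hx2)

end PolyCurve

/-! ### Uniform probability on finite types -/

section Probability

/-- The expectation of `f` at a uniformly random element of a finite type. -/
noncomputable def mean {Ω : Type*} [Fintype Ω] (f : Ω → ℝ) : ℝ := (∑ ω, f ω) / Fintype.card Ω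

open scoped Classical in
/-- The probability that a uniformly random element of a finite type satisfies `P`. -/
noncomputable def prob {Ω : Type*} [Fintype Ω] (P : Ω → Prop) : ℝ :=
  mean fun ω => if P ω then 1 else 0

variable {Ω Ω' Λ ι κ : Type*} [Fintype Ω] [Fintype Ω'] [Fintype Λ] [Fintype ι] [Fintype κ]

theorem mean_mono {f g : Ω → ℝ} (h : ∀ ω, f ω ≤ g ω) : mean f ≤ mean g :=
  div_le_div_of_nonneg_right (Finset.sum_le_sum fun ω _ => h ω) (Nat.cast_nonneg _)

theorem mean_nonneg {f : Ω → ℝ} (h : ∀ ω, 0 ≤ f ω) : 0 ≤ mean f :=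
  div_nonneg (Finset.sum_nonneg fun ω _ => h ω) (Nat.cast_nonneg _)

theorem mean_add (f g : Ω → ℝ) : mean (fun ω => f ω + g ω) = mean f + mean g := by
  simp only [mean, Finset.sum_add_distrib, add_div]

theorem mean_const_mul (c : ℝ) (f : Ω → ℝ) : mean (fun ω => c * f ω) = c * mean f := by
  simp only [mean, ← Finset.mul_sum, mul_div_assoc]

theorem mean_sum (f : ι → Ω → ℝ) : mean (fun ω => ∑ i, f i ω) = ∑ i, mean (f i) := by
  simp only [mean]
  rw [Finset.sum_comm, Finset.sum_div]

theorem mean_const [Nonempty Ω] (c : ℝ) : mean (fun _ : Ω => c) = c := by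
  have : (Fintype.card Ω : ℝ) ≠ 0 := by exact_mod_cast Fintype.card_ne_zero
  simp only [mean, Finset.sum_const, Finset.card_univ, nsmul_eq_mul]
  field_simp

theorem mean_comp_equiv (e : Ω ≃ Ω') (f : Ω' → ℝ) : mean (fun ω => f (e ω)) = mean f := by
  simp only [mean, Fintype.card_congr e, e.sum_comp]

theorem mean_prod (f : Ω × Ω' → ℝ) : mean f = mean fun a => mean fun b => f (a, b) := by
  simp only [mean, Fintype.sum_prod_type, Fintype.card_prod, Nat.cast_mul, ← Finset.sum_div]
  rw [div_div, mul_comm]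

theorem mean_pi_prod [DecidableEq ι] (f : ι → κ → ℝ) :
    mean (fun u : ι → κ => ∏ a, f a (u a)) = ∏ a, mean (f a) := by
  simp only [mean, Finset.prod_div_distrib]
  rw [Finset.prod_univ_sum, Fintype.piFinset_univ, Fintype.card_fun]
  simp

theorem prob_eq_card_div_card (P : Ω → Prop) [DecidablePred P] :
    prob P = (Finset.univ.filter P).card / Fintype.card Ω := by
  rw [prob, mean, ← Finset.sum_boole]
  congr!

theorem prob_nonneg (P : Ω → Prop) : 0 ≤ prob P :=
  mean_nonneg fun ω => by positivity

theorem prob_comp_equiv (e : Ω ≃ Ω') (P : Ω' → Prop) : prob (fun ω => P (e ω)) = prob P := by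
  classical
  exact mean_comp_equiv e fun ω => if P ω then 1 else 0

theorem prob_mono {P Q : Ω → Prop} (h : ∀ ω, P ω → Q ω) : prob P ≤ prob Q := by
  refine mean_mono fun ω => ?_
  by_cases hP : P ω
  · simp [hP, h ω hP]
  · simp only [hP, if_false]; positivity

theorem prob_le_one (P : Ω → Prop) : prob P ≤ 1 := by
  rcases isEmpty_or_nonempty Ω with h | h
  · simp [prob, mean]
  · calc prob P ≤ mean fun _ : Ω => (1 : ℝ) := mean_mono fun ω => by split_ifs <;> norm_num
      _ = 1 := mean_const 1

theorem prob_eq_zero {P : Ω → Prop} (h : ∀ ω, ¬P ω) : prob P = 0 := by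
  simp [prob, mean, h]

theorem prob_or_le (P Q : Ω → Prop) : prob (fun ω => P ω ∨ Q ω) ≤ prob P + prob Q := by
  rw [prob, prob, prob, ← mean_add]
  refine mean_mono fun ω => ?_
  by_cases hP : P ω <;> by_cases hQ : Q ω <;> simp [hP, hQ]

theorem prob_exists_le (P : ι → Ω → Prop) :
    prob (fun ω => ∃ i, P i ω) ≤ ∑ i, prob (P i) := by
  classical
  simp only [prob]
  rw [← mean_sum]
  refine mean_mono fun ω => ?_
  split_ifs with h
  · obtain ⟨i, hi⟩ := h
    refine le_trans ?_ (Finset.single_le_sum (f := fun i => if P i ω then (1 : ℝ) else 0)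
      (fun i _ => by positivity) (Finset.mem_univ i))
    simp [hi]
  · exact Finset.sum_nonneg fun i _ => by positivity

theorem prob_not [Nonempty Ω] (P : Ω → Prop) : prob (fun ω => ¬P ω) = 1 - prob P := by
  rw [eq_sub_iff_add_eq, prob, prob, ← mean_add]
  refine Eq.trans (congrArg mean (funext fun ω => ?_)) (mean_const (Ω := Ω) 1)
  by_cases hP : P ω <;> simp [hP]

theorem prob_prod_le {P : Ω × Ω' → Prop} {p : ℝ} (hp : 0 ≤ p)
    (h : ∀ a, prob (fun b => P (a, b)) ≤ p) : prob P ≤ p := by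
  rcases isEmpty_or_nonempty Ω with hΩ | hΩ
  · simpa [prob, mean] using hp
  · rw [prob, mean_prod, ← mean_const (Ω := Ω) p]
    exact mean_mono h

theorem prob_prod_fst [Nonempty Ω'] (P : Ω → Prop) :
    prob (fun ω : Ω × Ω' => P ω.1) = prob P := by
  classical
  rw [prob, mean_prod]
  refine congrArg mean (funext fun a => ?_)
  exact mean_const (Ω := Ω') (if P a then 1 else 0)

/-- Markov's inequality. -/
theorem mul_prob_le_mean {f : Ω → ℝ} (hf : ∀ ω, 0 ≤ f ω) {P : Ω → Prop} {c : ℝ}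
    (h : ∀ ω, P ω → c ≤ f ω) : c * prob P ≤ mean f := by
  rw [prob, ← mean_const_mul]
  refine mean_mono fun ω => ?_
  by_cases hP : P ω
  · simpa [hP] using h ω hP
  · simpa [hP] using hf ω

theorem eq_zero_of_mean_eq_zero [Nonempty Ω] {f : Ω → ℝ} (hf : ∀ ω, 0 ≤ f ω) (h0 : mean f = 0)
    (ω : Ω) : f ω = 0 := by
  have hc : (Fintype.card Ω : ℝ) ≠ 0 := by exact_mod_cast Fintype.card_ne_zero
  exact (Finset.sum_eq_zero_iff_of_nonneg fun ω _ => hf ω).1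
    ((div_eq_zero_iff.1 h0).resolve_right hc) ω (Finset.mem_univ ω)

theorem prob_mean_div_lt_le [Nonempty Ω] {f : Ω → ℝ} (hf : ∀ ω, 0 ≤ f ω) {t : ℝ} (ht : 0 < t) :
    prob (fun ω => mean f / t < f ω) ≤ t := by
  rcases (mean_nonneg hf).eq_or_lt with h0 | h0
  · rw [prob_eq_zero fun ω => by simp [← h0, eq_zero_of_mean_eq_zero hf h0.symm ω]]
    exact ht.le
  · have h := mul_prob_le_mean hf (P := fun ω => mean f / t < f ω) fun ω h => h.le
    rw [div_mul_eq_mul_div, div_le_iff₀ ht] at h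
    exact le_of_mul_le_mul_left h h0

theorem half_le_prob_le_two_mul_mean [Nonempty Ω] {f : Ω → ℝ} (hf : ∀ ω, 0 ≤ f ω) :
    1 / 2 ≤ prob fun ω => f ω ≤ 2 * mean f := by
  have h1 := prob_not fun ω => f ω ≤ 2 * mean f
  have h2 := prob_mean_div_lt_le hf one_half_pos
  have h3 : prob (fun ω => ¬f ω ≤ 2 * mean f) ≤ prob fun ω => mean f / (1 / 2) < f ω :=
    prob_mono fun ω h => by linarith [not_le.1 h]
  linarith

open scoped Classical in
/-- **Resampling.** Let `Φ ω v` replace the part `π ω` of the randomness `ω` by `v`, while it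
preserves the event `C`. Then, given `C`, the part `π ω` is uniformly distributed: the map
`(ω, v) ↦ (Φ ω v, π ω)` is an involution. -/
theorem mean_resample [Nonempty Λ] {π : Ω → Λ} {Φ : Ω → Λ → Ω} {C : Ω → Prop}
    (hC : ∀ ω v, C ω → C (Φ ω v)) (h₁ : ∀ ω v, C ω → π (Φ ω v) = v)
    (h₂ : ∀ ω v, C ω → Φ (Φ ω v) (π ω) = ω) (g : Λ → ℝ) :
    mean (fun ω => if C ω then g (π ω) else 0) = prob C * mean g := by
  have hΛ : (Fintype.card Λ : ℝ) ≠ 0 := by exact_mod_cast Fintype.card_ne_zero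
  have key : ∑ x ∈ (Finset.univ.filter C) ×ˢ (Finset.univ : Finset Λ), g (π x.1) =
      ∑ x ∈ (Finset.univ.filter C) ×ˢ (Finset.univ : Finset Λ), g x.2 := by
    refine Finset.sum_nbij' (fun x => (Φ x.1 x.2, π x.1)) (fun x => (Φ x.1 x.2, π x.1))
      ?_ ?_ ?_ ?_ ?_
    · rintro ⟨ω, v⟩ h
      simp only [Finset.mem_product, Finset.mem_filter, Finset.mem_univ, true_and, and_true] at h ⊢
      exact hC ω v h
    · rintro ⟨ω, v⟩ h
      simp only [Finset.mem_product, Finset.mem_filter, Finset.mem_univ, true_and, and_true] at h ⊢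
      exact hC ω v h
    · rintro ⟨ω, v⟩ h
      simp only [Finset.mem_product, Finset.mem_filter, Finset.mem_univ, true_and, and_true] at h
      simp [h₁ ω v h, h₂ ω v h]
    · rintro ⟨ω, v⟩ h
      simp only [Finset.mem_product, Finset.mem_filter, Finset.mem_univ, true_and, and_true] at h
      simp [h₁ ω v h, h₂ ω v h]
    · rintro ⟨ω, v⟩ h
      rfl
  rw [Finset.sum_product, Finset.sum_product] at key
  simp only [Finset.sum_const, nsmul_eq_mul, ← Finset.mul_sum, Finset.card_univ] at key
  have h3 : prob C = ((Finset.univ.filter C).card : ℝ) / Fintype.card Ω :=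
    prob_eq_card_div_card C
  rw [h3, mean, mean, ← Finset.sum_filter, div_mul_div_comm, ← key]
  field_simp

theorem prob_and_resample [Nonempty Λ] {π : Ω → Λ} {Φ : Ω → Λ → Ω} {C : Ω → Prop}
    (hC : ∀ ω v, C ω → C (Φ ω v)) (h₁ : ∀ ω v, C ω → π (Φ ω v) = v)
    (h₂ : ∀ ω v, C ω → Φ (Φ ω v) (π ω) = ω) (B : Λ → Prop) :
    prob (fun ω => C ω ∧ B (π ω)) = prob C * prob B := by
  classical
  rw [prob.eq_1 B, ← mean_resample hC h₁ h₂, prob]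
  congr 1
  ext ω
  by_cases hω : C ω <;> simp [hω]

theorem mean_eval [DecidableEq ι] [Nonempty κ] (f : κ → ℝ) (a : ι) :
    mean (fun u : ι → κ => f (u a)) = mean f := by
  have := mean_pi_prod (fun (b : ι) (k : κ) => if b = a then f k else 1)
  simp only [Finset.prod_ite_eq', Finset.mem_univ, if_true] at this
  rw [this, Finset.prod_eq_single a]
  · simp
  · intro b _ hb
    simp [hb, mean_const]
  · simp

/-- The probability that a sample misses a set. -/
theorem prob_forall_not [DecidableEq ι] [Nonempty κ] (F : κ → Prop) :
    prob (fun u : ι → κ => ∀ a, ¬F (u a)) = (1 - prob F) ^ Fintype.card ι := by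
  classical
  rw [← prob_not, prob, prob.eq_1 fun k => ¬F k, ← Finset.card_univ, ← Finset.prod_const,
    ← mean_pi_prod]
  congr 1
  ext u
  by_cases hu : ∀ a, ¬F (u a)
  · simp [hu]
  · rw [if_neg hu]
    push Not at hu
    obtain ⟨a, ha⟩ := hu
    exact (Finset.prod_eq_zero (Finset.mem_univ a) (by simp [ha])).symm

theorem one_sub_pow_le_exp {q : ℝ} (hq : q ≤ 1) (m : ℕ) : (1 - q) ^ m ≤ Real.exp (-(q * m)) := by
  calc (1 - q) ^ m ≤ (Real.exp (-q)) ^ m :=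
        pow_le_pow_left₀ (sub_nonneg.2 hq) (Real.one_sub_le_exp_neg q) m
    _ = Real.exp (-(q * m)) := by rw [← Real.exp_nat_mul]; congr 1; ring

theorem prob_forall_not_le [DecidableEq ι] [Nonempty κ] {F : κ → Prop} {q : ℝ} (hq : q ≤ prob F) :
    prob (fun u : ι → κ => ∀ a, ¬F (u a)) ≤ Real.exp (-(q * Fintype.card ι)) := by
  rw [prob_forall_not]
  calc _ ≤ (1 - q) ^ Fintype.card ι :=
        pow_le_pow_left₀ (sub_nonneg.2 (prob_le_one F)) (by linarith) _
    _ ≤ _ := one_sub_pow_le_exp (hq.trans (prob_le_one F)) _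

/-- A sample is unlikely to have all its scores below those of a fraction of more than `q` of the
population: it would miss the largest upper level set among those of such a fraction which are
bounded by a score of the sample. -/
theorem prob_exceed_le [DecidableEq ι] [Nonempty ι] [Nonempty κ] (f : κ → ℝ) (q : ℝ) :
    prob (fun u : ι → κ => q < prob fun k => ∀ a, f (u a) < f k) ≤
      Real.exp (-(q * Fintype.card ι)) := by
  classical
  have hmax : ∀ u : ι → κ, q < prob (fun k => ∀ a, f (u a) < f k) →
      ∃ a, (∀ a', f (u a') ≤ f (u a)) ∧ q < prob fun k => f (u a) < f k := by
    intro u hu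
    obtain ⟨a, ha⟩ := Finite.exists_max fun a => f (u a)
    exact ⟨a, ha, hu.trans_le (prob_mono fun k hk => hk a)⟩
  by_cases hV : ∃ v, q < prob fun k => f v < f k
  · obtain ⟨v, hv, hvmax⟩ := Finset.exists_max_image
      (Finset.univ.filter fun v => q < prob fun k => f v < f k) f (hV.imp fun v hv => Finset.mem_filter.2 ⟨Finset.mem_univ _, hv⟩)
    rw [Finset.mem_filter] at hv
    refine le_trans (prob_mono fun u hu => ?_) (prob_forall_not_le hv.2.le)
    obtain ⟨a, ha, hq⟩ := hmax u hu
    intro a'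
    exact not_lt.2 ((ha a').trans (hvmax _ (Finset.mem_filter.2 ⟨Finset.mem_univ _, hq⟩)))
  · rw [prob_eq_zero fun u hu => ?_]
    · positivity
    · obtain ⟨a, -, hq⟩ := hmax u hu
      exact hV ⟨_, hq⟩

/-- It is unlikely that for some member of a sample the other members all miss a set which is
determined by that member and has probability at least `q`. -/
theorem prob_exists_missed_le [DecidableEq ι] [Nonempty κ] (F : κ → κ → Prop) {q : ℝ} :
    prob (fun u : ι → κ => ∃ a, q ≤ prob (F (u a)) ∧ ∀ a', a' ≠ a → ¬F (u a) (u a')) ≤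
      Fintype.card ι * Real.exp (-(q * (Fintype.card ι - 1 : ℕ))) := by
  refine (prob_exists_le _).trans ?_
  rw [← nsmul_eq_mul, ← Finset.card_univ, ← Finset.sum_const]
  refine Finset.sum_le_sum fun a _ => ?_
  let P : κ × ({j // j ≠ a} → κ) → Prop := fun x => q ≤ prob (F x.1) ∧ ∀ j, ¬F x.1 (x.2 j)
  have hP : prob P ≤ Real.exp (-(q * (Fintype.card ι - 1 : ℕ))) := by
    refine prob_prod_le (by positivity) fun v => ?_
    by_cases hv : q ≤ prob (F v)
    · refine (prob_mono fun w hw => hw.2).trans ((prob_forall_not_le hv).trans_eq ?_)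
      simp
    · rw [prob_eq_zero fun w hw => hv hw.1]
      positivity
  rw [Finset.card_univ]
  refine le_trans ?_ hP
  rw [← prob_comp_equiv (Equiv.funSplitAt a κ)]
  exact prob_mono fun u hu => ⟨hu.1, fun j => hu.2 j j.2⟩

/-- A Chernoff bound for bounded functions whose mean is at least half of their bound. -/
theorem prob_sum_nonpos_le [DecidableEq ι] [Nonempty κ] {f : κ → ℝ} {b : ℝ} (hb : 0 < b)
    (hf : ∀ k, |f k| ≤ b) (hmean : b / 2 ≤ mean f) :
    prob (fun u : ι → κ => ∑ a, f (u a) ≤ 0) ≤ Real.exp (-(Fintype.card ι / 16)) := by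
  classical
  -- For `Z = f k / b` the bound `exp (-Z / 4) ≤ 1 - Z / 4 + Z ^ 2 / 16` has mean at most `15 / 16`.
  let g : κ → ℝ := fun k => Real.exp (-(f k / (4 * b)))
  have hg : mean g ≤ 1 - 1 / 16 := by
    have hgk : ∀ k, g k ≤ (1 + 1 / 16) + -(1 / (4 * b)) * f k := by
      intro k
      set x := f k / (4 * b) with hx
      have hx' : |x| ≤ 1 / 4 := by
        rw [hx, abs_div, abs_of_pos (by positivity : 0 < 4 * b), div_le_iff₀ (by positivity)]
        linarith [hf k]
      have h1 := Real.abs_exp_sub_one_sub_id_le (x := -x) (by rw [abs_neg]; linarith)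
      have h2 := (abs_le.1 h1).2
      have h3 : x ^ 2 ≤ 1 / 16 := by
        rw [← sq_abs]; nlinarith [abs_nonneg x]
      have h4 : -(1 / (4 * b)) * f k = -x := by rw [hx]; ring
      rw [h4]
      change Real.exp (-x) ≤ _
      nlinarith
    refine (mean_mono hgk).trans ?_
    rw [mean_add, mean_const, mean_const_mul]
    have : 1 / 8 ≤ 1 / (4 * b) * mean f := by
      rw [div_mul_eq_mul_div, one_mul, le_div_iff₀ (by positivity)]
      linarith
    linarith
  have h0 : 0 ≤ mean g := mean_nonneg fun k => (Real.exp_pos _).le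
  have hM := mul_prob_le_mean (f := fun u : ι → κ => ∏ a, g (u a)) (c := 1)
    (P := fun u => ∑ a, f (u a) ≤ 0) (fun u => Finset.prod_nonneg fun a _ => (Real.exp_pos _).le)
    (fun u hu => by
      rw [← Real.exp_sum, Real.one_le_exp_iff, Finset.sum_neg_distrib, ← Finset.sum_div, neg_nonneg]
      exact div_nonpos_of_nonpos_of_nonneg hu (by positivity))
  rw [one_mul, mean_pi_prod (fun _ => g), Finset.prod_const, Finset.card_univ] at hM
  calc _ ≤ _ := hM
    _ ≤ (1 - 1 / 16) ^ Fintype.card ι := pow_le_pow_left₀ h0 hg _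
    _ ≤ Real.exp (-(1 / 16 * Fintype.card ι)) := one_sub_pow_le_exp (by norm_num) _
    _ = _ := by congr 1; ring

/-- A lower-tail Chernoff bound for the number of hits of a set of probability at least `q`. -/
theorem prob_card_hits_le_le [DecidableEq ι] [Nonempty κ] {F : κ → Prop} [DecidablePred F]
    {q x : ℝ} (hq : q ≤ prob F) :
    prob (fun u : ι → κ => ((Finset.univ.filter fun a => F (u a)).card : ℝ) ≤ x) ≤
      Real.exp (x * Real.log 2 - q * Fintype.card ι / 2) := by
  -- Markov's inequality for `2 ^ (-(number of hits))`.
  let g : κ → ℝ := fun k => if F k then 1 / 2 else 1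
  have hg : mean g ≤ 1 - q / 2 := by
    have hgk : ∀ k, g k = 1 + -(1 / 2) * (if F k then 1 else 0) := by
      intro k
      by_cases h : F k <;> norm_num [g, h]
    have : mean g = 1 + -(1 / 2) * prob F := by
      rw [funext hgk, mean_add, mean_const, mean_const_mul, prob]; congr!
    linarith
  have h0 : 0 ≤ mean g := mean_nonneg fun k => by positivity
  have hM := mul_prob_le_mean (f := fun u : ι → κ => ∏ a, g (u a))
    (c := Real.exp (-(x * Real.log 2)))
    (P := fun u => ((Finset.univ.filter fun a => F (u a)).card : ℝ) ≤ x)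
    (fun u => Finset.prod_nonneg fun a _ => by positivity)
    (fun u hu => by
      rw [Finset.prod_ite, Finset.prod_const, Finset.prod_const_one, mul_one, one_div, inv_pow,
        ← Real.rpow_natCast, ← Real.rpow_neg (by norm_num), Real.rpow_def_of_pos (by norm_num)]
      rw [Real.exp_le_exp]
      nlinarith [Real.log_pos one_lt_two])
  rw [mean_pi_prod (fun _ => g), Finset.prod_const, Finset.card_univ] at hM
  have h1 : mean g ^ Fintype.card ι ≤ Real.exp (-(q / 2 * Fintype.card ι)) :=
    (pow_le_pow_left₀ h0 hg _).trans
      (one_sub_pow_le_exp (by linarith [hq.trans (prob_le_one F)]) _)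
  have h2 := hM.trans h1
  have h3 : Real.exp (x * Real.log 2 - q * Fintype.card ι / 2) =
      Real.exp (x * Real.log 2) * Real.exp (-(q / 2 * Fintype.card ι)) := by
    rw [← Real.exp_add]; congr 1; ring
  rw [h3]
  calc _ = Real.exp (x * Real.log 2) * (Real.exp (-(x * Real.log 2)) * _) := by
        rw [← mul_assoc, ← Real.exp_add, add_neg_cancel, Real.exp_zero, one_mul]
    _ ≤ _ := mul_le_mul_of_nonneg_left h2 (Real.exp_pos _).le

theorem uniformOn_univ_real [MeasurableSpace Ω] [MeasurableSingletonClass Ω] (P : Ω → Prop) :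
    (ProbabilityTheory.uniformOn (Set.univ : Set Ω)).real {ω | P ω} = prob P := by
  classical
  rw [MeasureTheory.measureReal_def, ProbabilityTheory.uniformOn_univ,
    MeasureTheory.Measure.count_apply_finite _ (Set.toFinite _), ENNReal.toReal_div]
  simp [prob, mean]

end Probability

/-! ### The approximation guarantee for the median by simplification -/

section Median34

variable {d ℓ : ℕ} {ι : Type}

theorem sizeS_pos {δ : ℝ} (h0 : 0 < δ) (h1 : δ < 1) : 0 < sizeS δ := by
  have := Real.log_neg h0 h1
  have := Real.log_pos one_lt_two
  exact Nat.ceil_pos.2 (by linarith)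

theorem exists_median34_eq {simplify : PolyCurve d → PolyCurve d}
    {argmin : Set (PolyCurve d) → (PolyCurve d → ℝ) → PolyCurve d}
    (hargmin : IsArgminRule argmin) {δ : ℝ} (h0 : 0 < δ) (h1 : δ < 1) (Y : ι → PolyCurve d)
    (ω : Coins34 ι δ) :
    (∃ i, median34 simplify argmin Y δ ω = simplify (Y (ω.1 i))) ∧
      ∀ i, cost (fun j => Y (ω.2 j)) (median34 simplify argmin Y δ ω) ≤
        cost (fun j => Y (ω.2 j)) (simplify (Y (ω.1 i))) := by
  have := hargmin (Set.range fun i => simplify (Y (ω.1 i))) (fun c => cost (fun j => Y (ω.2 j)) c)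
    (Set.finite_range _) ⟨_, Set.mem_range_self ⟨0, sizeS_pos h0 h1⟩⟩
  obtain ⟨⟨i, hi⟩, hmin⟩ := this
  exact ⟨⟨i, hi.symm⟩, fun j => hmin _ (Set.mem_range_self j)⟩

variable [Fintype ι]

theorem cost_nonneg (X : ι → PolyCurve d) (c : PolyCurve d) : 0 ≤ cost X c :=
  Finset.sum_nonneg fun _ _ => frechetDist_nonneg _ _

/-- The expected distance to `c` of a random member of `X`. -/
noncomputable def meanDist (X : ι → PolyCurve d) (c : PolyCurve d) : ℝ :=
  mean fun k => frechetDist (X k) c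

theorem cost_eq_card_mul_meanDist [Nonempty ι] (X : ι → PolyCurve d) (c : PolyCurve d) :
    cost X c = Fintype.card ι * meanDist X c := by
  have : (Fintype.card ι : ℝ) ≠ 0 := by exact_mod_cast Fintype.card_ne_zero
  simp only [cost, meanDist, mean]
  field_simp

theorem frechetDist_le_cost (X : ι → PolyCurve d) (c : PolyCurve d) (k : ι) :
    frechetDist (X k) c ≤ cost X c :=
  Finset.single_le_sum (f := fun k => frechetDist (X k) c) (fun _ _ => frechetDist_nonneg _ _)
    (Finset.mem_univ k)

theorem cost_le_cost_add (X : ι → PolyCurve d) (c c' : PolyCurve d) :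
    cost X c ≤ cost X c' + Fintype.card ι * frechetDist c' c := by
  rw [cost, cost, ← nsmul_eq_mul, ← Finset.card_univ, ← Finset.sum_const, ← Finset.sum_add_distrib]
  exact Finset.sum_le_sum fun k _ => frechetDist_triangle _ _ _

theorem frechetDist_simplify_le {simplify : PolyCurve d → PolyCurve d}
    (hsimplify : ∀ τ, IsApproxSimplification 4 ℓ τ (simplify τ)) {c : PolyCurve d}
    (hc : c.complexity ≤ ℓ) (τ : PolyCurve d) :
    frechetDist c (simplify τ) ≤ 5 * frechetDist τ c := by
  have h1 := (hsimplify τ).2 c hc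
  have h2 := frechetDist_triangle c τ (simplify τ)
  rw [frechetDist_comm c τ] at h2
  linarith

/-- Of two curves, the cheaper one is also cheaper for a random sample, if the costs differ by a
factor of at least three. -/
theorem prob_cost_le_cost_le [DecidableEq ι] [Nonempty ι] {m : ℕ} (Y : ι → PolyCurve d)
    {b c : PolyCurve d} (hb : 3 * cost Y b ≤ cost Y c) (hc : cost Y b < cost Y c) :
    prob (fun u : Fin m → ι => cost (fun j => Y (u j)) c ≤ cost (fun j => Y (u j)) b) ≤
      Real.exp (-((m : ℝ) / 16)) := by
  let f : ι → ℝ := fun k => frechetDist (Y k) c - frechetDist (Y k) b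
  have hι : (0 : ℝ) < Fintype.card ι := by exact_mod_cast Fintype.card_pos
  have hf : ∀ k, |f k| ≤ frechetDist b c := by
    intro k
    have h1 := frechetDist_triangle (Y k) b c
    have h2 := frechetDist_triangle (Y k) c b
    rw [frechetDist_comm c b] at h2
    exact abs_le.2 ⟨by simp only [f]; linarith, by simp only [f]; linarith⟩
  have hsum : Fintype.card ι * frechetDist b c ≤ cost Y b + cost Y c := by
    rw [cost, cost, ← nsmul_eq_mul, ← Finset.card_univ, ← Finset.sum_const,
      ← Finset.sum_add_distrib]
    refine Finset.sum_le_sum fun k _ => ?_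
    have := frechetDist_triangle b (Y k) c
    rwa [frechetDist_comm b (Y k)] at this
  have hpos : 0 < frechetDist b c := by
    have := cost_le_cost_add Y c b
    by_contra! h
    nlinarith
  have hmean : frechetDist b c / 2 ≤ mean f := by
    rw [mean, le_div_iff₀ hι, Finset.sum_sub_distrib]
    change _ ≤ cost Y c - cost Y b
    linarith
  have := prob_sum_nonpos_le (ι := Fin m) hpos hf hmean
  rw [Fintype.card_fin] at this
  refine le_trans (prob_mono fun u hu => ?_) this
  rw [Finset.sum_sub_distrib]
  exact sub_nonpos.2 hu

theorem exp_neg_sizeS_le {δ : ℝ} (h0 : 0 < δ) :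
    Real.exp (-(1 / 2 * (sizeS δ : ℝ))) ≤ δ / 2 := by
  have h : 2 * (Real.log 2 - Real.log δ) ≤ sizeS δ := Nat.le_ceil _
  calc _ ≤ Real.exp (Real.log (δ / 2)) := by
        rw [Real.exp_le_exp, Real.log_div h0.ne' two_ne_zero]; linarith
    _ = _ := Real.exp_log (by positivity)

theorem sizeS_mul_exp_neg_sizeW_le {δ : ℝ} (h0 : 0 < δ) (h1 : δ ≤ 1 / 4) :
    (sizeS δ : ℝ) * Real.exp (-((sizeW δ : ℝ) / 16)) ≤ δ / 2 := by
  set K : ℝ := (⌈4 * Real.log 2 - Real.log δ⌉₊ : ℝ) with hK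
  have hlog2 := Real.log_two_gt_d9
  have hlogδ : Real.log δ < 0 := Real.log_neg h0 (by linarith)
  have hKle : 4 * Real.log 2 - Real.log δ ≤ K := Nat.le_ceil _
  have hK1 : 1 ≤ K := by linarith
  have hW : -64 * (Real.log δ - Real.log K) ≤ sizeW δ := Nat.le_ceil _
  have hS : (sizeS δ : ℝ) ≤ 2 * K := by
    have := Nat.ceil_lt_add_one (a := 2 * (Real.log 2 - Real.log δ)) (by linarith)
    change (⌈2 * (Real.log 2 - Real.log δ)⌉₊ : ℝ) ≤ _
    linarith
  have hexp : Real.exp (-((sizeW δ : ℝ) / 16)) ≤ (δ / K) ^ 4 := by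
    have hpos : 0 < δ / K := by positivity
    calc _ ≤ Real.exp ((4 : ℕ) * Real.log (δ / K)) := by
          rw [Real.exp_le_exp, Real.log_div h0.ne' (by positivity)]
          push_cast
          linarith
      _ = _ := by rw [Real.exp_nat_mul, Real.exp_log hpos]
  have hδK : δ / K ≤ δ := div_le_self h0.le hK1
  have hδK0 : 0 ≤ δ / K := by positivity
  calc _ ≤ 2 * K * (δ / K) ^ 4 := by gcongr
    _ = 2 * (K * (δ / K)) * (δ / K) ^ 3 := by ring
    _ = 2 * δ * (δ / K) ^ 3 := by rw [mul_div_cancel₀ δ (by positivity : K ≠ 0)]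
    _ ≤ 2 * δ * (1 / 4) ^ 3 := by
      have := pow_le_pow_left₀ hδK0 (hδK.trans h1) 3
      gcongr
    _ ≤ δ / 2 := by linarith

/-- The approximation guarantee, with respect to a fixed curve. A member of the first sample which
is no farther from `cstar` than twice the average has a simplification of cost at most
`11 * cost Y cstar`; simplifications that are three times as expensive lose against it on the second
sample. -/
theorem prob_median34_le [DecidableEq ι] [Nonempty ι] {simplify : PolyCurve d → PolyCurve d}
    (hsimplify : ∀ τ, IsApproxSimplification 4 ℓ τ (simplify τ))
    {argmin : Set (PolyCurve d) → (PolyCurve d → ℝ) → PolyCurve d}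
    (hargmin : IsArgminRule argmin) {δ : ℝ} (h0 : 0 < δ) (h1 : δ ≤ 1 / 4) (Y : ι → PolyCurve d)
    {cstar : PolyCurve d} (hc : cstar.complexity ≤ ℓ) :
    prob (fun ω : Coins34 ι δ =>
      34 * cost Y cstar < cost Y (median34 simplify argmin Y δ ω)) ≤ δ := by
  set m := meanDist Y cstar
  have hcm : cost Y cstar = Fintype.card ι * m := cost_eq_card_mul_meanDist Y cstar
  have hc0 := cost_nonneg Y cstar
  have hgood : ∀ k, frechetDist (Y k) cstar ≤ 2 * m →
      cost Y (simplify (Y k)) ≤ 11 * cost Y cstar := by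
    intro k hk
    have h2 := cost_le_cost_add Y (simplify (Y k)) cstar
    have h3 := frechetDist_simplify_le hsimplify hc (Y k)
    have h4 : (Fintype.card ι : ℝ) * frechetDist cstar (simplify (Y k)) ≤
        Fintype.card ι * (10 * m) := by gcongr; linarith
    rw [hcm] at h2 ⊢
    linarith
  -- `P`: the first sample has no good member; `R`: it has one, which loses on the second sample.
  let P : Coins34 ι δ → Prop := fun ω => ∀ i, ¬frechetDist (Y (ω.1 i)) cstar ≤ 2 * m
  let R : Coins34 ι δ → Prop := fun ω =>
    (∃ i, frechetDist (Y (ω.1 i)) cstar ≤ 2 * m) ∧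
      34 * cost Y cstar < cost Y (median34 simplify argmin Y δ ω)
  have hP : prob P ≤ δ / 2 := by
    refine le_trans ?_ (exp_neg_sizeS_le h0)
    have := prob_forall_not_le (ι := Fin (sizeS δ))
      (half_le_prob_le_two_mul_mean fun k => frechetDist_nonneg (Y k) cstar)
    rw [Fintype.card_fin] at this
    refine le_trans (le_of_eq ?_) this
    exact prob_prod_fst (Ω' := Fin (sizeW δ) → ι)
      fun u : Fin (sizeS δ) → ι => ∀ i, ¬frechetDist (Y (u i)) cstar ≤ 2 * m
  have hR : prob R ≤ δ / 2 := by
    refine le_trans ?_ (sizeS_mul_exp_neg_sizeW_le h0 h1)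
    refine prob_prod_le (by positivity) fun u => ?_
    by_cases hu : ∃ i, frechetDist (Y (u i)) cstar ≤ 2 * m
    · obtain ⟨i₀, hi₀⟩ := hu
      have h11 := hgood _ hi₀
      refine le_trans (prob_mono (Q := fun w => ∃ i : Fin (sizeS δ),
        34 * cost Y cstar < cost Y (simplify (Y (u i))) ∧
        cost (fun j => Y (w j)) (simplify (Y (u i))) ≤
          cost (fun j => Y (w j)) (simplify (Y (u i₀)))) ?_) ?_
      · rintro w ⟨-, hw⟩
        obtain ⟨⟨i, hi⟩, hmin⟩ := exists_median34_eq (simplify := simplify) hargmin h0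
          (h1.trans_lt (by norm_num)) Y (u, w)
        have := hmin i₀
        rw [hi] at hw this
        exact ⟨i, hw, this⟩
      · refine (prob_exists_le _).trans ?_
        refine (Finset.sum_le_card_nsmul _ _ (Real.exp (-((sizeW δ : ℝ) / 16)))
          fun i _ => ?_).trans_eq ?_
        · by_cases hi : 34 * cost Y cstar < cost Y (simplify (Y (u i)))
          · exact (prob_mono fun w hw => hw.2).trans
              (prob_cost_le_cost_le Y (by linarith) (by linarith))
          · rw [prob_eq_zero fun w hw => hi hw.1]
            positivity
        · rw [Finset.card_univ, Fintype.card_fin, nsmul_eq_mul]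
    · rw [prob_eq_zero fun w hw => hu hw.1]
      positivity
  calc _ ≤ prob (fun ω => P ω ∨ R ω) := prob_mono fun ω hω => by
        by_cases h : ∃ i, frechetDist (Y (ω.1 i)) cstar ≤ 2 * m
        · exact Or.inr ⟨h, hω⟩
        · exact Or.inl fun i hi => h ⟨i, hi⟩
    _ ≤ prob P + prob R := prob_or_le P R
    _ ≤ δ := by linarith

end Median34

/-! ### Candidates for a good sample -/

section Candidate

variable {d ℓ : ℕ}

theorem norm_sub_gridPoint_le {ρ : ℝ} (hρ : 0 < ρ) (p : Pt d) :
    ‖p - gridPoint ρ p‖ ≤ Real.sqrt d * ρ := by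
  have hcoord : ∀ i, ‖(p - gridPoint ρ p) i‖ ^ 2 ≤ ρ ^ 2 := by
    intro i
    have h1 := Int.floor_le (p i / ρ)
    have h2 := Int.lt_floor_add_one (p i / ρ)
    rw [le_div_iff₀ hρ] at h1
    rw [div_lt_iff₀ hρ] at h2
    have h3 : (p - gridPoint ρ p) i = p i - ⌊p i / ρ⌋ * ρ := rfl
    rw [h3, Real.norm_eq_abs, sq_abs]
    nlinarith
  rw [EuclideanSpace.norm_eq]
  refine Real.sqrt_le_iff.2 ⟨by positivity, ?_⟩
  rw [mul_pow, Real.sq_sqrt (Nat.cast_nonneg d)]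
  refine (Finset.sum_le_sum fun i _ => hcoord i).trans_eq ?_
  simp

/-- The vertices of a curve can be moved to grid points. -/
theorem exists_grid_curve {ι : Type} {n N : ℕ} (hd : 1 ≤ d) (hn : 1 ≤ n) (hN : 0 < N) {δ ε' Δ : ℝ}
    (hδ : 0 < δ) (hε' : 0 < ε') (hΔ : 0 < Δ) (Y : ι → PolyCurve d) {σ : PolyCurve d}
    (hσ : ∀ i, ∃ a j, ‖σ.vertex i - (Y a).vertex j‖ ≤ 4 * ℓ / ε' * (1 / ε' * Δ)) :
    ∃ σ' : PolyCurve d, σ'.complexity = σ.complexity ∧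
      (∀ i, σ'.vertex i ∈ gridPoints n ℓ N δ ε' Δ Y) ∧
      frechetDist σ σ' ≤ 2 * ε' / n * (2 * δ * n / (4 * N) * (Δ / 34)) := by
  set Δl : ℝ := 2 * δ * n / (4 * N) * (Δ / 34) with hΔl
  have hn' : (0 : ℝ) < n := by exact_mod_cast hn
  have hN' : (0 : ℝ) < N := by exact_mod_cast hN
  have hd' : (0 : ℝ) < Real.sqrt d := Real.sqrt_pos.2 (by exact_mod_cast hd)
  set ρ : ℝ := 2 * ε' / (n * Real.sqrt d) * Δl with hρ
  have hρ0 : 0 < ρ := by positivity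
  refine ⟨⟨σ.edges, fun i => gridPoint ρ (σ.vertex i), σ.instant, σ.instant_strictMono,
    σ.instant_zero, σ.instant_last⟩, rfl, fun i => ?_, ?_⟩
  · obtain ⟨a, j, haj⟩ := hσ i
    refine Set.mem_iUnion.2 ⟨a, Set.mem_iUnion.2 ⟨j, hρ0, σ.vertex i, ?_, rfl⟩⟩
    rw [Metric.mem_closedBall, dist_eq_norm]
    exact haj
  · have hle : 2 * ε' / n * Δl = Real.sqrt d * ρ := by
      rw [hρ]; field_simp
    rw [hle]
    exact frechetDist_le_of_vertex σ.instant_strictMono σ.instant_zero σ.instant_last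
      fun i => norm_sub_gridPoint_le hρ0 _

variable {κ ι : Type} [Fintype κ]

theorem meanDist_nonneg (X : κ → PolyCurve d) (c : PolyCurve d) : 0 ≤ meanDist X c :=
  mean_nonneg fun _ => frechetDist_nonneg _ _

variable [Nonempty κ]

theorem meanDist_le_add (X : κ → PolyCurve d) (b c : PolyCurve d) :
    meanDist X c ≤ meanDist X b + frechetDist b c := by
  rw [← mean_const (Ω := κ) (frechetDist b c), meanDist, meanDist, ← mean_add]
  exact mean_mono fun k => frechetDist_triangle _ _ _

/-- If at least two thirds of the curves are much closer to `c` than `b` is, then `c` is at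
least as good a median as `b`. -/
theorem meanDist_le_of_prob_far_le (X : κ → PolyCurve d) (b c : PolyCurve d)
    (hfar : prob (fun k => frechetDist b c < 4 * frechetDist (X k) c) ≤ 1 / 3) :
    meanDist X c ≤ meanDist X b := by
  classical
  set a := frechetDist b c with ha
  have ha0 : 0 ≤ a := frechetDist_nonneg _ _
  have hpt : ∀ k, frechetDist (X k) c ≤ frechetDist (X k) b +
      (3 * a / 2 * (if a < 4 * frechetDist (X k) c then 1 else 0) + -(a / 2)) := by
    intro k
    have h1 := frechetDist_triangle (X k) b c
    have h2 := frechetDist_triangle b (X k) c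
    rw [frechetDist_comm b (X k)] at h2
    split_ifs with h <;> linarith
  have := mean_mono hpt
  rw [mean_add, mean_add, mean_const, mean_const_mul] at this
  change meanDist X c ≤ meanDist X b + (3 * a / 2 * prob _ + -(a / 2)) at this
  nlinarith

/-- The cost of a shortcut curve `σ`: the curves outside the exceptional set are charged to `b`,
the others are charged to the sampled curve `X k₀` as well. -/
theorem meanDist_le_of_prob_exceed_le {B : Type} [Fintype B] (X : κ → PolyCurve d)
    {b σ : PolyCurve d} {score : B → κ → ℝ} {u : ι → κ} {η q e : ℝ}
    (hσ : ∀ k, (∀ i, ∃ a, score i k ≤ score i (u a)) →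
      frechetDist (X k) σ ≤ frechetDist (X k) b + η)
    {a₀ : ι} (ha₀ : frechetDist (X (u a₀)) b ≤ 2 * meanDist X b)
    (hscore : ∀ i, prob (fun k => ∀ a, score i (u a) < score i k) ≤ q)
    (hq : Fintype.card B * q ≤ e) :
    meanDist X σ ≤ meanDist X b + η + 4 * e * meanDist X b := by
  classical
  have hM := meanDist_nonneg X b
  obtain ⟨bad, hbad_iff⟩ : ∃ bad : κ → Prop, ∀ k, bad k ↔ ∃ i, ∀ a, score i (u a) < score i k :=
    ⟨_, fun _ => Iff.rfl⟩
  have hbad : prob bad ≤ e := by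
    refine (prob_mono fun k => (hbad_iff k).1).trans ?_
    refine (prob_exists_le fun i k => ∀ a, score i (u a) < score i k).trans ?_
    refine (Finset.sum_le_card_nsmul _ _ q fun i _ => hscore i).trans ?_
    rw [nsmul_eq_mul, Finset.card_univ]
    exact hq
  have hpt : ∀ k, frechetDist (X k) σ ≤ (frechetDist (X k) b + η) +
      4 * meanDist X b * (if bad k then 1 else 0) := by
    intro k
    by_cases hk : bad k
    · have h2 := frechetDist_triangle (X k) b σ
      have h3 := frechetDist_triangle b (X (u a₀)) σ
      rw [frechetDist_comm b (X (u a₀))] at h3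
      have h4 := hσ (u a₀) fun i => ⟨a₀, le_rfl⟩
      rw [if_pos hk]
      linarith
    · rw [if_neg hk]
      rw [hbad_iff] at hk
      push Not at hk
      linarith [hσ k hk]
  have h := mean_mono hpt
  rw [mean_add, mean_add, mean_const, mean_const_mul] at h
  change meanDist X σ ≤ meanDist X b + η + 4 * meanDist X b * prob bad at h
  have := mul_le_mul_of_nonneg_left hbad (by positivity : 0 ≤ 4 * meanDist X b)
  linarith

variable [Fintype ι]

/-- The deterministic part of the analysis: for a good sample `u`, the candidates include
a curve that is almost as good as the curve `b`. The three cases are that `c` is far from `b`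
compared to `Δ`, so that `c` is better than `b`; that `c` is very close to `b`; and that `b` is
close enough to the sample for its shortcut version to be covered by the grids. -/
theorem exists_mem_subsampleCandidates {B : Type} [Fintype B] {n N : ℕ} (hd : 1 ≤ d)
    (hn : 1 ≤ n) (hℓ : 3 ≤ ℓ) (hN : 0 < N) {δ ε' η q : ℝ} (hδ : 0 < δ) (hε' : 0 < ε')
    (hε'1 : ε' ≤ 1) (hη : 0 < η) {X : κ → PolyCurve d} {b c : PolyCurve d}
    (hηle : 0 < meanDist X b → η ≤ ε' / 4 * meanDist X b)
    {score : B → κ → ℝ} {u : ι → κ} (hcard : 8 * (Fintype.card ι : ℝ) ≤ 5 * N)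
    (hshort : ∃ σ : PolyCurve d, σ.complexity ≤ 2 * ℓ - 2 ∧
      (∀ i, ∃ a j, ‖σ.vertex i - (X (u a)).vertex j‖ ≤ frechetDist (X (u a)) b + η) ∧
      ∀ k, (∀ i, ∃ a, score i k ≤ score i (u a)) → frechetDist (X k) σ ≤ frechetDist (X k) b + η)
    (hnear : ∃ a, frechetDist (X (u a)) b ≤ 2 * meanDist X b)
    (hscore : ∀ i, prob (fun k => ∀ a, score i (u a) < score i k) ≤ q)
    (hq : Fintype.card B * q ≤ ε' / 2)
    (hfar : (∀ a, ¬frechetDist b c < 4 * frechetDist (X (u a)) c) →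
      prob (fun k => frechetDist b c < 4 * frechetDist (X k) c) ≤ 1 / 3)
    (hmarkov : cost (fun a => X (u a)) b ≤ 4 * Fintype.card ι / δ * meanDist X b)
    (happrox : cost (fun a => X (u a)) c ≤ 34 * cost (fun a => X (u a)) b)
    (hcℓ : c.complexity ≤ ℓ) :
    ∃ c' ∈ subsampleCandidates n ℓ N δ ε' (fun a => X (u a)) c,
      c'.complexity ≤ 2 * ℓ - 2 ∧ meanDist X c' ≤ (1 + 5 * ε') * meanDist X b := by
  set Y : ι → PolyCurve d := fun a => X (u a) with hY
  set Δ := cost Y c with hΔ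
  have hM := meanDist_nonneg X b
  have hℓ' : (3 : ℝ) ≤ ℓ := by exact_mod_cast hℓ
  have hcmem : c ∈ subsampleCandidates n ℓ N δ ε' Y c := Or.inl rfl
  have hccomp : c.complexity ≤ 2 * ℓ - 2 := by omega
  have hdc : ∀ a, frechetDist (Y a) c ≤ Δ := frechetDist_le_cost Y c
  by_cases hcase : 4 * Δ ≤ frechetDist b c
  · have := meanDist_le_of_prob_far_le X b c (hfar fun a => not_lt.2 (by linarith [hdc a]))
    exact ⟨c, hcmem, hccomp, by nlinarith⟩
  push Not at hcase
  have hΔ0 : 0 < Δ := by linarith [frechetDist_nonneg b c]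
  have hMpos : 0 < meanDist X b := by
    refine hM.lt_of_ne fun h0 => ?_
    rw [← h0, mul_zero] at hmarkov
    linarith
  have hηle := hηle hMpos
  have hdb : ∀ a, frechetDist (Y a) b ≤ 5 * Δ := by
    intro a
    have := frechetDist_triangle (Y a) c b
    rw [frechetDist_comm c b] at this
    linarith [hdc a]
  have hK : 12 * Δ ≤ 4 * ℓ / ε' * (1 / ε' * Δ) := by
    have h1 : 12 ≤ 4 * ℓ / ε' := by
      rw [le_div_iff₀ hε']; nlinarith
    have h2 : Δ ≤ 1 / ε' * Δ := le_mul_of_one_le_left hΔ0.le (by rw [le_div_iff₀ hε']; linarith)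
    exact mul_le_mul h1 h2 hΔ0.le (by positivity)
  by_cases hcase2 : 7 * Δ < η
  · have := meanDist_le_add X b c
    exact ⟨c, hcmem, hccomp, by nlinarith⟩
  push Not at hcase2
  obtain ⟨σ, hσcomp, hσvert, hσdist⟩ := hshort
  obtain ⟨a₀, ha₀⟩ := hnear
  obtain ⟨σ', hcomp, hgrid, hdist⟩ := exists_grid_curve (ℓ := ℓ) hd hn hN hδ hε' hΔ0 Y (σ := σ) (by
    intro i
    obtain ⟨a, j, haj⟩ := hσvert i
    exact ⟨a, j, haj.trans (by linarith [hdb a])⟩)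
  refine ⟨σ', Or.inr ⟨hcomp ▸ hσcomp, hgrid⟩, hcomp ▸ hσcomp, ?_⟩
  have h1 := meanDist_le_of_prob_exceed_le X hσdist ha₀ hscore hq
  have h2 := meanDist_le_add X σ σ'
  have hn' : (0 : ℝ) < n := by exact_mod_cast hn
  have hN' : (0 : ℝ) < N := by exact_mod_cast hN
  have h3 : 2 * ε' / n * (2 * δ * n / (4 * N) * (Δ / 34)) ≤ 5 / 2 * ε' * meanDist X b := by
    calc 2 * ε' / n * (2 * δ * n / (4 * N) * (Δ / 34))
        ≤ 2 * ε' / n * (2 * δ * n / (4 * N) * (4 * Fintype.card ι / δ * meanDist X b)) := by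
          gcongr; linarith
      _ = 4 * ε' * (Fintype.card ι / N) * meanDist X b := by field_simp; ring
      _ ≤ 4 * ε' * (5 / 8) * meanDist X b := by
          have : (Fintype.card ι : ℝ) / N ≤ 5 / 8 := by rw [div_le_iff₀ hN']; linarith
          gcongr
      _ = _ := by ring
  nlinarith

end Candidate

/-! ### Random samples of the curves -/

section Sample

variable {d ℓ : ℕ} {κ ι : Type} [Fintype κ] [Nonempty κ]

/-- Up to a factor arbitrarily close to one there is an optimal median of complexity at most `ℓ`. If
the optimal cost is zero, then the simplification of any of the curves attains it. -/
theorem exists_isApproxMedian {simplify : PolyCurve d → PolyCurve d}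
    (hsimplify : ∀ τ, IsApproxSimplification 4 ℓ τ (simplify τ)) (X : κ → PolyCurve d) {e : ℝ}
    (he : 0 < e) : ∃ b : PolyCurve d, b.complexity ≤ ℓ ∧ IsApproxMedian (1 + e) ℓ X b := by
  let S : Set ℝ := cost X '' {c | c.complexity ≤ ℓ}
  let k₀ : κ := Classical.arbitrary κ
  have hS : S.Nonempty := ⟨_, simplify (X k₀), (hsimplify _).1, rfl⟩
  have hbdd : BddBelow S := ⟨0, by rintro _ ⟨c, -, rfl⟩; exact cost_nonneg X c⟩
  have hle : ∀ c : PolyCurve d, c.complexity ≤ ℓ → sInf S ≤ cost X c := fun c hc =>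
    csInf_le hbdd ⟨c, hc, rfl⟩
  have h0 : 0 ≤ sInf S := le_csInf hS (by rintro _ ⟨c, -, rfl⟩; exact cost_nonneg X c)
  rcases h0.eq_or_lt with h0 | h0
  · refine ⟨simplify (X k₀), (hsimplify _).1, fun c hc => ?_⟩
    have hκ : (0 : ℝ) ≤ Fintype.card κ := Nat.cast_nonneg _
    have hkey : ∀ c' : PolyCurve d, c'.complexity ≤ ℓ →
        cost X (simplify (X k₀)) ≤ (1 + 5 * Fintype.card κ) * cost X c' := by
      intro c' hc'
      have h1 := cost_le_cost_add X (simplify (X k₀)) c'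
      have h2 := frechetDist_simplify_le hsimplify hc' (X k₀)
      have h3 := frechetDist_le_cost X c' k₀
      nlinarith
    have hz : cost X (simplify (X k₀)) ≤ 0 := by
      by_contra! hpos
      have : sInf S < cost X (simplify (X k₀)) / (1 + 5 * Fintype.card κ) := by
        rw [← h0]; positivity
      obtain ⟨_, ⟨c', hc', rfl⟩, hlt⟩ := exists_lt_of_csInf_lt hS this
      rw [lt_div_iff₀ (by positivity)] at hlt
      linarith [hkey c' hc']
    have := cost_nonneg X c
    exact hz.trans (by positivity)
  · obtain ⟨_, ⟨b, hb, rfl⟩, hlt⟩ := exists_lt_of_csInf_lt hS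
      (lt_mul_of_one_lt_left h0 (by linarith : 1 < 1 + e))
    exact ⟨b, hb, fun c hc => hlt.le.trans (mul_le_mul_of_nonneg_left (hle c hc) (by linarith))⟩

variable [Fintype ι] [DecidableEq ι]

theorem prob_mul_meanDist_lt_cost_le (X : κ → PolyCurve d) (b : PolyCurve d) {t : ℝ} (ht : 0 < t) :
    prob (fun u : ι → κ => Fintype.card ι / t * meanDist X b < cost (fun a => X (u a)) b) ≤ t := by
  have hmean : mean (fun u : ι → κ => cost (fun a => X (u a)) b) =
      Fintype.card ι * meanDist X b := by
    simp only [cost]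
    rw [mean_sum, Finset.sum_congr rfl fun a _ =>
      mean_eval (fun k => frechetDist (X k) b) a]
    simp [meanDist]
  refine le_trans (prob_mono fun u hu => ?_) (prob_mean_div_lt_le
    (f := fun u : ι → κ => cost (fun a => X (u a)) b) (fun u => cost_nonneg _ _) ht)
  rwa [hmean, mul_div_right_comm]

variable [Nonempty ι]

/-- The probability, over a sample `u` of the curves `X` and the random choices for the
approximation, that the candidates for this sample do not include a curve almost as good as
`b`. -/
theorem prob_sample_fails_le {n N : ℕ} (hd : 1 ≤ d) (hn : 1 ≤ n) (hℓ : 3 ≤ ℓ) (hN : 0 < N)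
    {δ ε' : ℝ} (hδ : 0 < δ) (hδ1 : δ ≤ 1) (hε' : 0 < ε') (hε'1 : ε' ≤ 1)
    {simplify : PolyCurve d → PolyCurve d}
    (hsimplify : ∀ τ, IsApproxSimplification 4 ℓ τ (simplify τ))
    {argmin : Set (PolyCurve d) → (PolyCurve d → ℝ) → PolyCurve d}
    (hargmin : IsArgminRule argmin) (X : κ → PolyCurve d) {b : PolyCurve d}
    (hb : b.complexity ≤ ℓ) (hcard : 8 * (Fintype.card ι : ℝ) ≤ 5 * N)
    (hexp : Real.exp (-(ε' / (2 * (2 * ℓ - 4)) * Fintype.card ι)) ≤ δ / (4 * (2 * ℓ - 4))) :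
    prob (fun x : (ι → κ) × Coins34 ι (δ / 4) =>
      ¬∃ c ∈ subsampleCandidates n ℓ N δ ε' (fun a => X (x.1 a))
          (median34 simplify argmin (fun a => X (x.1 a)) (δ / 4) x.2),
        c.complexity ≤ 2 * ℓ - 2 ∧ meanDist X c ≤ (1 + 5 * ε') * meanDist X b) ≤
      3 / 4 * δ + Real.exp (-(1 / 2 * Fintype.card ι)) +
        Fintype.card ι * Real.exp (-(1 / 3 * (Fintype.card ι - 1 : ℕ))) := by
  have hℓ' : (3 : ℝ) ≤ ℓ := by exact_mod_cast hℓ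
  set q : ℝ := ε' / (2 * (2 * ℓ - 4)) with hq
  -- If all distances to `b` vanish, then the value of `η` does not matter.
  obtain ⟨η, hη, hηle⟩ : ∃ η : ℝ, 0 < η ∧ (0 < meanDist X b → η ≤ ε' / 4 * meanDist X b) := by
    by_cases hM : 0 < meanDist X b
    · exact ⟨_, by positivity, fun _ => le_rfl⟩
    · exact ⟨1, one_pos, fun h => absurd h hM⟩
  obtain ⟨score, hshort⟩ := b.exists_shortcut X (fun k => frechetDist (X k) b + η)
    fun k => lt_add_of_pos_right _ hη
  have hB : (Fintype.card (b.Interior × Bool) : ℝ) ≤ 2 * ℓ - 4 := by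
    have : Fintype.card (b.Interior × Bool) + 4 ≤ 2 * ℓ := by
      rw [Fintype.card_prod, b.card_interior, Fintype.card_bool]; omega
    have : (Fintype.card (b.Interior × Bool) : ℝ) + 4 ≤ 2 * ℓ := by exact_mod_cast this
    linarith
  have hpos : (0 : ℝ) < 2 * ℓ - 4 := by linarith
  have hBq : Fintype.card (b.Interior × Bool) * q ≤ ε' / 2 := by
    calc _ ≤ (2 * ℓ - 4) * q := by gcongr
      _ = ε' / 2 := by rw [hq]; field_simp
  -- The exceptional events: the sample is too expensive for `b` (`E₀`), has no member near `b`
  -- (`E₁`), misses the top quantile of a score (`E₂`), is misleadingly close to the simplification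
  -- of one of its members (`E₃`), or the approximation fails on it (`E₄`).
  let E₀ : (ι → κ) → Prop := fun u =>
    Fintype.card ι / (δ / 4) * meanDist X b < cost (fun a => X (u a)) b
  let E₁ : (ι → κ) → Prop := fun u => ∀ a, ¬frechetDist (X (u a)) b ≤ 2 * meanDist X b
  let E₂ : (ι → κ) → Prop := fun u => ∃ i, q < prob fun k => ∀ a, score i (u a) < score i k
  let far : κ → κ → Prop := fun v k =>
    frechetDist b (simplify (X v)) < 4 * frechetDist (X k) (simplify (X v))
  let E₃ : (ι → κ) → Prop := fun u =>
    ∃ a, 1 / 3 ≤ prob (far (u a)) ∧ ∀ a', a' ≠ a → ¬far (u a) (u a')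
  let E₄ : (ι → κ) × Coins34 ι (δ / 4) → Prop := fun x =>
    34 * cost (fun a => X (x.1 a)) b <
      cost (fun a => X (x.1 a)) (median34 simplify argmin (fun a => X (x.1 a)) (δ / 4) x.2)
  have h₀ : prob E₀ ≤ δ / 4 := prob_mul_meanDist_lt_cost_le X b (by positivity)
  have h₁ : prob E₁ ≤ Real.exp (-(1 / 2 * Fintype.card ι)) :=
    prob_forall_not_le (half_le_prob_le_two_mul_mean fun k => frechetDist_nonneg (X k) b)
  have h₂ : prob E₂ ≤ δ / 4 := by
    refine (prob_exists_le _).trans ((Finset.sum_le_card_nsmul _ _ _ fun i _ =>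
      (prob_exceed_le (score i) q).trans hexp).trans ?_)
    rw [nsmul_eq_mul, Finset.card_univ]
    calc _ ≤ (2 * ℓ - 4) * (δ / (4 * (2 * ℓ - 4))) := by gcongr
      _ = δ / 4 := by field_simp
  have h₃ : prob E₃ ≤ Fintype.card ι * Real.exp (-(1 / 3 * (Fintype.card ι - 1 : ℕ))) :=
    prob_exists_missed_le far
  have h₄ : prob E₄ ≤ δ / 4 := prob_prod_le (by positivity) fun u =>
    prob_median34_le hsimplify hargmin (by positivity) (by linarith) (fun a => X (u a)) hb
  calc _ ≤ prob fun x : (ι → κ) × Coins34 ι (δ / 4) =>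
        (E₀ x.1 ∨ E₁ x.1 ∨ E₂ x.1 ∨ E₃ x.1) ∨ E₄ x := prob_mono ?_
    _ ≤ prob (fun x : (ι → κ) × Coins34 ι (δ / 4) => E₀ x.1 ∨ E₁ x.1 ∨ E₂ x.1 ∨ E₃ x.1) +
        prob E₄ := prob_or_le _ _
    _ = prob (fun u => E₀ u ∨ E₁ u ∨ E₂ u ∨ E₃ u) + prob E₄ := by
        rw [prob_prod_fst (Ω' := Coins34 ι (δ / 4)) fun u => E₀ u ∨ E₁ u ∨ E₂ u ∨ E₃ u]
    _ ≤ prob E₀ + (prob E₁ + (prob E₂ + prob E₃)) + prob E₄ := by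
        gcongr
        refine (prob_or_le _ _).trans ?_
        gcongr
        refine (prob_or_le _ _).trans ?_
        gcongr
        exact prob_or_le _ _
    _ ≤ _ := by linarith
  rintro ⟨u, x⟩ hfail
  by_contra hgood
  simp only [not_or] at hgood
  obtain ⟨⟨g₀, g₁, g₂, g₃⟩, g₄⟩ := hgood
  apply hfail
  obtain ⟨⟨i, hi⟩, -⟩ := exists_median34_eq (simplify := simplify) hargmin
    (by positivity : 0 < δ / 4) (by linarith) (fun a => X (u a)) x
  set c := median34 simplify argmin (fun a => X (u a)) (δ / 4) x with hc
  obtain ⟨σ, hσ, hσ'⟩ := hshort ι u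
  simp only [E₁, not_forall, not_not] at g₁
  simp only [E₂, not_exists, not_lt] at g₂
  refine exists_mem_subsampleCandidates hd hn hℓ hN hδ hε' hε'1 hη hηle hcard
    ⟨σ, by omega, hσ'⟩ g₁ g₂ hBq ?_ ?_ (not_lt.1 g₄) (hi ▸ (hsimplify _).1)
  · intro hno
    by_contra! hlt
    refine g₃ ⟨x.1 i, ?_⟩
    simp only [far, ← hi]
    exact ⟨hlt.le, fun a _ => hno a⟩
  · refine (not_lt.1 g₀).trans_eq ?_
    rw [div_div_eq_mul_div, mul_comm (Fintype.card ι : ℝ) 4]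

end Sample

section Sizes

/-- The three exceptional events with exponentially small probability: they are negligible for
samples as large as those of the algorithm. -/
theorem exp_add_exp_add_mul_exp_le {L w δ : ℝ} {m : ℕ} (hδ : 0 < δ) (hδ1 : δ ≤ 1)
    (hL : 1 ≤ L) (hLδ : Real.exp (-L) ≤ δ / 8) (hw : 400 * L ≤ w) (hm : w ≤ m) :
    Real.exp (w * Real.log 2 - w) + Real.exp (-(1 / 2 * m)) +
      m * Real.exp (-(1 / 3 * (m - 1 : ℕ))) ≤ δ / 4 := by
  have hlog := Real.log_two_lt_d9
  have h2 : Real.exp (-(2 * L)) ≤ δ / 64 := by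
    have : Real.exp (-(2 * L)) = Real.exp (-L) * Real.exp (-L) := by
      rw [← Real.exp_add]; congr 1; ring
    have h0 := Real.exp_pos (-L)
    rw [this]
    nlinarith
  have h1 : Real.exp (w * Real.log 2 - w) ≤ Real.exp (-(2 * L)) := by
    rw [Real.exp_le_exp]; nlinarith
  have h3 : Real.exp (-(1 / 2 * m)) ≤ Real.exp (-(2 * L)) := by
    rw [Real.exp_le_exp]; linarith
  have hm1 : 1 ≤ m := by
    have : (0 : ℝ) < m := by linarith
    exact_mod_cast this
  have h4 : (m : ℝ) * Real.exp (-(1 / 3 * (m - 1 : ℕ))) ≤ 6 * Real.exp (-(2 * L)) := by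
    have h5 : (m : ℝ) ≤ 6 * Real.exp (m / 6) := by
      have := Real.add_one_le_exp ((m : ℝ) / 6)
      linarith
    calc _ ≤ 6 * Real.exp (m / 6) * Real.exp (-(1 / 3 * (m - 1 : ℕ))) := by gcongr
      _ = 6 * Real.exp (m / 6 + -(1 / 3 * (m - 1 : ℕ))) := by rw [mul_assoc, ← Real.exp_add]
      _ ≤ _ := by
        gcongr
        rw [Nat.cast_sub hm1]
        push_cast
        linarith
  linarith

variable {ℓ : ℕ} {β δ ε : ℝ}

theorem one_le_log_sub_log (hℓ : 3 ≤ ℓ) (hδ₀ : 0 < δ) (hδ₁ : δ < 1) :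
    1 ≤ Real.log (4 * (2 * (ℓ : ℝ) - 4)) - Real.log δ := by
  have hℓ' : (3 : ℝ) ≤ ℓ := by exact_mod_cast hℓ
  have h1 : Real.log 8 ≤ Real.log (4 * (2 * (ℓ : ℝ) - 4)) :=
    Real.log_le_log (by norm_num) (by linarith)
  have h2 : Real.log 8 = 3 * Real.log 2 := by
    rw [show (8 : ℝ) = 2 ^ 3 by norm_num, Real.log_pow]; norm_num
  have := Real.log_two_gt_d9
  have := Real.log_neg hδ₀ hδ₁
  linarith

theorem exp_neg_log_sub_log (hℓ : 3 ≤ ℓ) (hδ₀ : 0 < δ) :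
    Real.exp (-(Real.log (4 * (2 * (ℓ : ℝ) - 4)) - Real.log δ)) = δ / (4 * (2 * ℓ - 4)) := by
  have hℓ' : (3 : ℝ) ≤ ℓ := by exact_mod_cast hℓ
  rw [neg_sub, Real.exp_sub, Real.exp_log hδ₀, Real.exp_log (by linarith)]

theorem le_sampleSize_div (hβ : 1 ≤ β) (hε₀ : 0 < ε) :
    4 * ℓ / (ε / 6) * (Real.log (4 * (2 * (ℓ : ℝ) - 4)) - Real.log δ) ≤
      sampleSize ℓ β δ ε / (2 * β) := by
  have h : -8 * β * ℓ * (ε / 6)⁻¹ * (Real.log δ - Real.log (4 * (2 * (ℓ : ℝ) - 4))) ≤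
    sampleSize ℓ β δ ε := Nat.le_ceil _
  rw [le_div_iff₀ (by linarith)]
  refine le_trans (le_of_eq ?_) h
  field_simp
  ring

theorem mul_le_sampleSize_div (hℓ : 3 ≤ ℓ) (hδ₀ : 0 < δ) (hδ₁ : δ < 1) (hβ : 1 ≤ β) (hε₀ : 0 < ε)
    (hε₁ : ε ≤ 0.158) :
    400 * (Real.log (4 * (2 * (ℓ : ℝ) - 4)) - Real.log δ) ≤ sampleSize ℓ β δ ε / (2 * β) := by
  have hℓ' : (3 : ℝ) ≤ ℓ := by exact_mod_cast hℓ
  have hL := one_le_log_sub_log hℓ hδ₀ hδ₁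
  refine le_trans ?_ (le_sampleSize_div hβ hε₀)
  have : (400 : ℝ) ≤ 4 * ℓ / (ε / 6) := by
    rw [le_div_iff₀ (by positivity)]
    norm_num at hε₁
    linarith
  gcongr

theorem subsampleSize_bounds (hℓ : 3 ≤ ℓ) (hδ₀ : 0 < δ) (hδ₁ : δ < 1) (hβ : 1 ≤ β) (hε₀ : 0 < ε)
    (hε₁ : ε ≤ 0.158) : 0 < sampleSize ℓ β δ ε ∧ 0 < subsampleSize ℓ β δ ε ∧
      8 * (subsampleSize ℓ β δ ε : ℝ) ≤ 5 * sampleSize ℓ β δ ε := by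
  have hL := one_le_log_sub_log hℓ hδ₀ hδ₁
  have hw := mul_le_sampleSize_div hℓ hδ₀ hδ₁ hβ hε₀ hε₁
  have hlt := Nat.ceil_lt_add_one (a := (sampleSize ℓ β δ ε : ℝ) / (2 * β)) (by positivity)
  have hle : (sampleSize ℓ β δ ε : ℝ) / (2 * β) ≤ sampleSize ℓ β δ ε / 2 := by
    gcongr; linarith
  change (subsampleSize ℓ β δ ε : ℝ) < _ at hlt
  refine ⟨?_, ?_, by linarith⟩
  · have : (0 : ℝ) < sampleSize ℓ β δ ε := by linarith
    exact_mod_cast this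
  · exact Nat.ceil_pos.2 (by linarith)

theorem exp_neg_mul_subsampleSize_le (hℓ : 3 ≤ ℓ) (hδ₀ : 0 < δ) (hδ₁ : δ < 1) (hβ : 1 ≤ β)
    (hε₀ : 0 < ε) :
    Real.exp (-(ε / 6 / (2 * (2 * ℓ - 4)) * subsampleSize ℓ β δ ε)) ≤ δ / (4 * (2 * ℓ - 4)) := by
  have hℓ' : (3 : ℝ) ≤ ℓ := by exact_mod_cast hℓ
  have hpos : (0 : ℝ) < 2 * ℓ - 4 := by linarith
  have hL := one_le_log_sub_log hℓ hδ₀ hδ₁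
  rw [← exp_neg_log_sub_log hℓ hδ₀, Real.exp_le_exp, neg_le_neg_iff]
  set L := Real.log (4 * (2 * (ℓ : ℝ) - 4)) - Real.log δ
  have hm : 4 * ℓ / (ε / 6) * L ≤ subsampleSize ℓ β δ ε :=
    (le_sampleSize_div hβ hε₀).trans (Nat.le_ceil _)
  calc L ≤ 2 * ℓ / (2 * ℓ - 4) * L :=
        le_mul_of_one_le_left (by linarith) (by rw [le_div_iff₀ hpos]; linarith)
    _ = ε / 6 / (2 * (2 * ℓ - 4)) * (4 * ℓ / (ε / 6) * L) := by field_simp; ring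
    _ ≤ _ := by gcongr

end Sizes

/-! ### Resampling the random choices -/

section Coins

open scoped Classical in
/-- A conditional form of the law of total probability. -/
theorem prob_le_of_forall_eq_and {Ω Λ : Type*} [Fintype Ω] [Fintype Λ] {H : Ω → Λ}
    {B : Λ → Ω → Prop} {p : ℝ} (hp : 0 ≤ p)
    (h : ∀ l, prob (fun ω => H ω = l ∧ B l ω) ≤ prob (fun ω => H ω = l) * p) :
    prob (fun ω => B (H ω) ω) ≤ p := by
  have hsum : ∑ l, prob (fun ω => H ω = l) ≤ 1 := by
    simp only [prob]
    rw [← mean_sum]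
    simp only [Finset.sum_ite_eq, Finset.mem_univ, if_true]
    rcases isEmpty_or_nonempty Ω with hΩ | hΩ
    · simp [mean]
    · rw [mean_const]
  calc _ ≤ prob (fun ω => ∃ l, H ω = l ∧ B l ω) := prob_mono fun ω hω => ⟨_, rfl, hω⟩
    _ ≤ ∑ l, prob (fun ω => H ω = l ∧ B l ω) := prob_exists_le _
    _ ≤ ∑ l, prob (fun ω => H ω = l) * p := Finset.sum_le_sum fun l _ => h l
    _ ≤ p := by
      rw [← Finset.sum_mul]
      exact mul_le_of_le_one_left hp hsum

variable {n ℓ : ℕ} {β δ ε : ℝ}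

/-- The positions of the sample that hold members of `T'`. -/
noncomputable def hits (T' : Finset (Fin n)) (ω : Coins n ℓ β δ ε) :
    Finset (Fin (sampleSize ℓ β δ ε)) :=
  Finset.univ.filter fun j => ω.1 j ∈ T'

open scoped Classical in
/-- Given the set `H` of positions that hold members of `T'`, the members at a subset `A` of these
positions, together with the random choices for `A`, are uniformly distributed. -/
theorem prob_hits_eq_and_le (T' : Finset (Fin n)) [Nonempty {i // i ∈ T'}]
    {H : Finset (Fin (sampleSize ℓ β δ ε))} (A : Subsample ℓ β δ ε) (hA : A.1 ⊆ H)
    (hApos : A.1.Nonempty)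
    (B : ({j // j ∈ A.1} → {i // i ∈ T'}) × Coins34 {j // j ∈ A.1} (δ / 4) → Prop) :
    prob (fun ω : Coins n ℓ β δ ε => hits T' ω = H ∧
      ∃ h : ∀ j : {j // j ∈ A.1}, ω.1 j ∈ T', B (fun j => ⟨ω.1 j, h j⟩, ω.2 A)) ≤
      prob (fun ω : Coins n ℓ β δ ε => hits T' ω = H) * prob B := by
  let Λ := ({j // j ∈ A.1} → {i // i ∈ T'}) × Coins34 {j // j ∈ A.1} (δ / 4)
  have hne : Nonempty {j // j ∈ A.1} := hApos.to_subtype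
  let π : Coins n ℓ β δ ε → Λ := fun ω =>
    (fun j => if h : ω.1 j ∈ T' then ⟨ω.1 j, h⟩ else Classical.arbitrary _, ω.2 A)
  let Φ : Coins n ℓ β δ ε → Λ → Coins n ℓ β δ ε := fun ω v =>
    (fun j => if h : j ∈ A.1 then v.1 ⟨j, h⟩ else ω.1 j, Function.update ω.2 A v.2)
  have hmem : ∀ ω : Coins n ℓ β δ ε, hits T' ω = H → ∀ j ∈ A.1, ω.1 j ∈ T' := by
    rintro ω rfl j hj
    exact (Finset.mem_filter.1 (hA hj)).2
  have key := prob_and_resample (π := π) (Φ := Φ) (C := fun ω => hits T' ω = H) ?_ ?_ ?_ B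
  · rw [← key]
    refine prob_mono ?_
    rintro ω ⟨hω, h, hB⟩
    refine ⟨hω, ?_⟩
    have : π ω = (fun j => ⟨ω.1 j, h j⟩, ω.2 A) :=
      Prod.ext (funext fun j => dif_pos (h j)) rfl
    rwa [this]
  · rintro ω v rfl
    ext j
    by_cases hj : j ∈ A.1
    · have h1 : ω.1 j ∈ T' := hmem ω rfl j hj
      have h2 : ((v.1 ⟨j, hj⟩ : {i // i ∈ T'}) : Fin n) ∈ T' := (v.1 ⟨j, hj⟩).2
      simp [hits, Φ, hj, h1, h2]
    · simp [hits, Φ, hj]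
  · rintro ω v -
    refine Prod.ext (funext fun j => ?_) ?_
    · have h2 : ((v.1 j : {i // i ∈ T'}) : Fin n) ∈ T' := (v.1 j).2
      simp [π, Φ, h2]
    · simp [π, Φ]
  · intro ω v hω
    refine Prod.ext (funext fun j => ?_) ?_
    · by_cases hj : j ∈ A.1
      · simp [π, Φ, hj, hmem ω hω j hj]
      · simp [Φ, hj]
    · simp [π, Φ]

end Coins

/-! ### The success probability of the algorithm -/

theorem mainTheorem2 (d ℓ n : ℕ) (hd : 1 ≤ d) (hℓ : 3 ≤ ℓ) (hn : 1 ≤ n)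
    (simplify : PolyCurve d → PolyCurve d)
    (hsimplify : ∀ τ, IsApproxSimplification 4 ℓ τ (simplify τ))
    (argmin : Set (PolyCurve d) → (PolyCurve d → ℝ) → PolyCurve d)
    (hargmin : IsArgminRule argmin)
    (β δ ε : ℝ) (hβ : 1 ≤ β) (hδ₀ : 0 < δ) (hδ₁ : δ < 1) (hε₀ : 0 < ε) (hε₁ : ε ≤ 0.158)
    (T : Fin n → PolyCurve d) (T' : Finset (Fin n)) (hT' : 1 / β * (n : ℝ) ≤ T'.card) :
    1 - δ ≤ (ProbabilityTheory.uniformOn (Set.univ : Set (Coins n ℓ β δ ε))).real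
      {ω | ∃ c ∈ candidates simplify argmin ℓ T β δ ε ω,
        c.complexity ≤ 2 * ℓ - 2 ∧
          IsApproxMedian (1 + ε) ℓ (fun i : {i // i ∈ T'} => T i) c} := by
  classical
  have hε₁' : ε ≤ 1 := hε₁.trans (by norm_num)
  have hn' : (0 : ℝ) < n := by exact_mod_cast hn
  have hβ0 : 0 < β := by linarith
  obtain ⟨hNpos, hmpos, hmN⟩ := subsampleSize_bounds hℓ hδ₀ hδ₁ hβ hε₀ hε₁
  have : Nonempty (Fin n) := ⟨⟨0, hn⟩⟩
  have hT'ne : Nonempty {i // i ∈ T'} := by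
    have : (0 : ℝ) < T'.card := lt_of_lt_of_le (by positivity) hT'
    exact (Finset.card_pos.1 (by exact_mod_cast this)).to_subtype
  have hAne : ∀ A : Subsample ℓ β δ ε, A.1.Nonempty := fun A =>
    Finset.card_pos.1 (A.2.symm ▸ hmpos)
  have hAne' : ∀ A : Subsample ℓ β δ ε, Nonempty {j // j ∈ A.1} := fun A => (hAne A).to_subtype
  have hcoins : Nonempty (Coins n ℓ β δ ε) := inferInstance
  set X : {i // i ∈ T'} → PolyCurve d := fun i => T i with hX
  obtain ⟨b, hbℓ, hb⟩ := exists_isApproxMedian hsimplify X (e := ε / 12) (by positivity)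
  rw [uniformOn_univ_real]
  -- The total error: `(1 + 5 * ε') * (1 + ε' / 2) ≤ 1 + 6 * ε'`.
  have hmedian : ∀ c, meanDist X c ≤ (1 + 5 * (ε / 6)) * meanDist X b →
      IsApproxMedian (1 + ε) ℓ X c := by
    intro c hc c' hc'
    have h1 := hb c' hc'
    have h2 := cost_nonneg X c'
    have h3 : cost X c ≤ (1 + 5 * (ε / 6)) * cost X b := by
      rw [cost_eq_card_mul_meanDist, cost_eq_card_mul_meanDist]
      calc _ ≤ (Fintype.card {i // i ∈ T'} : ℝ) * ((1 + 5 * (ε / 6)) * meanDist X b) := by gcongr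
        _ = _ := by ring
    have h4 : (1 + 5 * (ε / 6)) * cost X b ≤ (1 + 5 * (ε / 6)) * ((1 + ε / 12) * cost X c') := by
      gcongr
    have h5 : (1 + 5 * (ε / 6)) * (1 + ε / 12) ≤ 1 + ε := by nlinarith
    nlinarith
  let good : Coins n ℓ β δ ε → Prop := fun ω => ∃ c ∈ candidates simplify argmin ℓ T β δ ε ω,
    c.complexity ≤ 2 * ℓ - 2 ∧ IsApproxMedian (1 + ε) ℓ X c
  set w : ℝ := sampleSize ℓ β δ ε / (2 * β) with hw
  set m := subsampleSize ℓ β δ ε with hm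
  set p : ℝ := 3 / 4 * δ + Real.exp (-(1 / 2 * m)) + m * Real.exp (-(1 / 3 * (m - 1 : ℕ))) with hp
  have hp0 : 0 ≤ p := by positivity
  -- Few positions of the sample hold members of `T'`.
  have hfew : prob (fun ω : Coins n ℓ β δ ε => (hits T' ω).card < m) ≤
      Real.exp (w * Real.log 2 - w) := by
    have hprob : 1 / β ≤ prob fun i : Fin n => i ∈ T' := by
      have : prob (fun i : Fin n => i ∈ T') = T'.card / n := by
        rw [prob_eq_card_div_card, Fintype.card_fin, Finset.filter_univ_mem]
      rw [this, le_div_iff₀ hn']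
      exact hT'
    have := prob_card_hits_le_le (ι := Fin (sampleSize ℓ β δ ε)) (x := w) hprob
    rw [Fintype.card_fin] at this
    have hexp : 1 / β * sampleSize ℓ β δ ε / 2 = w := by rw [hw]; field_simp
    rw [hexp, ← prob_prod_fst
      (Ω' := (A : Subsample ℓ β δ ε) → Coins34 {j // j ∈ A.1} (δ / 4))] at this
    refine le_trans (prob_mono fun ω hω => ?_) this
    exact (Nat.lt_ceil.1 hω).le
  -- Otherwise, fix a subset of these positions that depends on nothing but the set of the hits;
  -- the members of `T'` that it holds form a uniform sample, which is good with high probability.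
  have hmany : prob (fun ω : Coins n ℓ β δ ε => m ≤ (hits T' ω).card ∧ ¬good ω) ≤ p := by
    refine prob_le_of_forall_eq_and (H := hits T') (B := fun H ω => m ≤ H.card ∧ ¬good ω) hp0
      fun H => ?_
    by_cases hH : m ≤ H.card
    · obtain ⟨A, hAH, hAcard⟩ := Finset.exists_subset_card_eq hH
      let A' : Subsample ℓ β δ ε := ⟨A, hAcard⟩
      have hcardA : Fintype.card {j // j ∈ A'.1} = m := by rw [Fintype.card_coe]; exact hAcard
      have hsample := prob_sample_fails_le (ι := {j // j ∈ A'.1}) (n := n)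
        (N := sampleSize ℓ β δ ε) hd hn hℓ hNpos hδ₀ hδ₁.le (ε' := ε / 6) (by positivity)
        (by linarith) hsimplify hargmin X hbℓ (by rw [hcardA]; exact hmN)
        (by rw [hcardA]; exact exp_neg_mul_subsampleSize_le hℓ hδ₀ hδ₁ hβ hε₀)
      rw [hcardA] at hsample
      refine le_trans ?_ (mul_le_mul_of_nonneg_left hsample (prob_nonneg _))
      refine le_trans (prob_mono ?_) (prob_hits_eq_and_le T' A' hAH (hAne A') _)
      rintro ω ⟨hω, -, hbad⟩
      have hsub : A'.1 ⊆ hits T' ω := hω ▸ hAH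
      refine ⟨hω, fun j => (Finset.mem_filter.1 (hsub j.2)).2, fun ⟨c, hc, hcℓ, hcb⟩ => ?_⟩
      exact hbad ⟨c, Set.mem_iUnion.2 ⟨A', hc⟩, hcℓ, hmedian c hcb⟩
    · rw [prob_eq_zero fun ω hω => hH hω.2.1]
      exact mul_nonneg (prob_nonneg _) hp0
  have hbad : prob (fun ω => ¬good ω) ≤ Real.exp (w * Real.log 2 - w) + p := by
    refine le_trans (prob_mono fun ω hω => ?_) ((prob_or_le _ _).trans (add_le_add hfew hmany))
    rcases lt_or_ge (hits T' ω).card m with h | h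
    · exact Or.inl h
    · exact Or.inr ⟨h, hω⟩
  have hsmall := exp_add_exp_add_mul_exp_le (m := m) hδ₀ hδ₁.le (one_le_log_sub_log hℓ hδ₀ hδ₁)
    (by
      have hℓ' : (3 : ℝ) ≤ ℓ := by exact_mod_cast hℓ
      rw [exp_neg_log_sub_log hℓ hδ₀]
      gcongr
      linarith)
    (mul_le_sampleSize_div hℓ hδ₀ hδ₁ hβ hε₀ hε₁) (Nat.le_ceil _)
  rw [prob_not] at hbad
  change 1 - δ ≤ prob good
  linarith
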